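/- Let $E=\{e_0<e_1<e_2<\dots\}\subset\mathbb{R}_{\ge 0}$ be an infinite set without accumulation points in $\mathbb{R}$. **Conventions.** For a countable set $\mathfrak X$, a *matrix of transition rates* on $\mathfrak X$ is a real matrix $Q=[q_{i,j}]_{i,j\in\mathfrak X}$ with $q_{i,j}\ge 0$ for $i\ne j$ and $q_i:=-q_{i,i}=\sum_{j\ne i}q_{i,j}<\infty$ for all $i$. Put $$P^{[0]}(t;i,j)=e^{-q_it}\mathbf 1_{\{i=j\}},\qquad P^{[n]}(t;i,j)=\int_0^t e^{-q_is}\sum_{k\neq i}q_{i,k}P^{[n-1]}(t-s;k,j)\,ds\quad(n\ge 1),$$ and $\overline P(t)=\sum_{n\ge 0}P^{[n]}(t)$. The matrix $Q$ is *non-explosive* if all $\overline P(t)$, $t\ge 0$, are stochastic. A *Markov semigroup* is a family $(P(t))_{t\ge 0}$ of stochastic matrices with $P(0)=I$, $P(t+s)=P(t)P(s)$ for all $t,s\ge 0$, and $P(t)\to I$ entrywise as $t\downarrow 0$; its $q$-matrix is the entrywise limit $\lim_{h\downarrow 0}(P(h)-I)/h$. **Hypotheses.** Let $Q=[q_{x,y}]_{x,y\in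 E}$ be a non-explosive matrix of transition rates on $E$ that is tridiagonal, i.e. $q_{x,y}=0$ unless $x$ and $y$ are equal or neighbouring elements of $E$. Let $(\mathcal D f)(x)=\sum_{y\in E}q_{x,y}f(y)$, and for functions of $N$ variables let $\mathcal D^{[i]}$ be $\mathcal D$ acting on the $i$-th variable. Assume that $\mathcal D$ is well-defined on polynomial functions and that, for each integer $m\ge 0$, $\mathcal D x^m$ is a polynomial in $x\in E$ of degree at most $m$. Let $N\ge 1$, $\Delta_N(x_1,\dots,x_N)=\prod_{i<j}(x_i-x_j)$, and assume that for some real constant $c_N$ $$(\mathcal D^{[1]}+\dots+\mathcal D^{[N]})\Delta_N=c_N\Delta_N\quad\text{on }E^N.$$ Let $E_N=\{\mathbf x\in E^N: x_1>\dots>x_N\}$ and, for $\mathbf x,\mathbf y\in E_N$, $$Q^{(N)}(\mathbf x,\mathbf y)=\frac{\Delta_N(\mathbf y)}{\Delta_N(\mathbf x)}\sum_{i=1}^N q_{x_i,y_i}\mathbf 1_{\{x_j=y_j\ \forall j\ne i\}}-c_N\mathbf 1_{\{\mathbf x=\mathbf y\}}.$$ **Conclusion.** $Q^{(N)}$ is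 a matrix of transition rates on $E_N$ and it is non-explosive. There is a unique Markov semigroup $(P_1(t))_{t\ge0}$ with $q$-matrix $Q$, and a unique Markov semigroup $(P_N(t))_{t\ge 0}$ with $q$-matrix $Q^{(N)}$; they are the semigroups $\overline P(t)$ constructed as above from $Q$ and from $Q^{(N)}$, respectively. Moreover $$P_N(t;\mathbf x,\mathbf y)=e^{-c_Nt}\,\frac{\Delta_N(\mathbf y)}{\Delta_N(\mathbf x)}\,\det_{1\le i,j\le N}\big[P_1(t;x_i,y_j)\big],\qquad t\ge 0,\ \mathbf x,\mathbf y\in E_N.$$ -/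

import Mathlib

open Filter Topology Polynomial
open scoped NNReal

noncomputable section

namespace JumpChain

/-! ### Rate matrices and Markov semigroups on a countable set -/

section General

variable {X : Type*} [DecidableEq X]

/-- A (stable, conservative) matrix of transition rates: the off-diagonal entries are nonnegative
and `q_i = -q_{i,i}` is the sum of the off-diagonal entries of row `i`. -/
structure IsRateMatrix (Q : Matrix X X ℝ) : Prop where
  nonneg : ∀ i j, i ≠ j → 0 ≤ Q i j
  conservative : ∀ i, HasSum (fun j => if j = i then 0 else Q i j) (-Q i i)

/-- `jumpTerm Q n t i j` is the matrix `P^{[n]}(t; i, j)` (exactly `n` jumps in `[0, t]`):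
`P^{[0]}(t; i, j) = e^{-q_i t} 1_{i = j}` and
`P^{[n+1]}(t; i, j) = ∫_0^t e^{-q_i s} ∑_{k ≠ i} q_{i,k} P^{[n]}(t - s; k, j) ds`,
where `q_i = -Q i i`. -/
def jumpTerm (Q : Matrix X X ℝ) : ℕ → ℝ → Matrix X X ℝ
  | 0, t => fun i j => if i = j then Real.exp (Q i i * t) else 0
  | n + 1, t => fun i j =>
      ∫ s in (0 : ℝ)..t,
        Real.exp (Q i i * s) * ∑' k, if k = i then 0 else Q i k * jumpTerm Q n (t - s) k j

/-- The semigroup `P̄(t) = ∑_n P^{[n]}(t)` constructed from the rate matrix `Q`. -/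
def minimalSemigroup (Q : Matrix X X ℝ) (t : ℝ) : Matrix X X ℝ :=
  fun i j => ∑' n, jumpTerm Q n t i j

/-- A matrix with nonnegative entries and all row sums equal to `1`. -/
structure IsStochastic (P : Matrix X X ℝ) : Prop where
  nonneg : ∀ i j, 0 ≤ P i j
  row_sum : ∀ i, HasSum (fun j => P i j) 1

/-- A rate matrix is non-explosive (regular) if all the matrices `P̄(t)`, `t ≥ 0`, are
stochastic. -/
structure IsNonExplosive (Q : Matrix X X ℝ) : Prop where
  isRateMatrix : IsRateMatrix Q
  stochastic : ∀ t : ℝ, 0 ≤ t → IsStochastic (minimalSemigroup Q t)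

/-- A standard Markov semigroup `(P(t))_{t ≥ 0}`: stochastic matrices with `P(0) = I`, the
Chapman-Kolmogorov equations and `P(t) → I` entrywise as `t ↓ 0`. -/
structure IsMarkovSemigroup (P : ℝ≥0 → Matrix X X ℝ) : Prop where
  stochastic : ∀ t, IsStochastic (P t)
  zero : P 0 = 1
  chapman_kolmogorov : ∀ t s i j, HasSum (fun k => P t i k * P s k j) (P (t + s) i j)
  standard : ∀ i j, Tendsto (fun t => P t i j) (𝓝[>] 0) (𝓝 ((1 : Matrix X X ℝ) i j))

/-- `Q` is the `q`-matrix of `P`: `Q = lim_{h ↓ 0} (P(h) - I) / h` entrywise. -/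
def HasQMatrix (P : ℝ≥0 → Matrix X X ℝ) (Q : Matrix X X ℝ) : Prop :=
  ∀ i j, Tendsto (fun h : ℝ≥0 => (P h i j - (1 : Matrix X X ℝ) i j) / (h : ℝ)) (𝓝[>] 0)
    (𝓝 (Q i j))

/-- `P` is the one and only standard Markov semigroup with `q`-matrix `Q`. -/
structure IsUniqueMarkovSemigroup (P : ℝ≥0 → Matrix X X ℝ) (Q : Matrix X X ℝ) : Prop where
  isMarkovSemigroup : IsMarkovSemigroup P
  hasQMatrix : HasQMatrix P Q
  unique : ∀ P' : ℝ≥0 → Matrix X X ℝ, IsMarkovSemigroup P' → HasQMatrix P' Q → P' = P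

end General

/-! ### The state space `E = {e 0 < e 1 < e 2 < …}` and its difference operators

The set `E` is given by its increasing enumeration `e : ℕ → ℝ`; a state is its index in `ℕ`, and
functions on `E` are functions of the index. -/

/-- `e` enumerates increasingly an infinite subset of `[0, ∞)` without accumulation points. -/
structure IsStateSpace (e : ℕ → ℝ) : Prop where
  strictMono : StrictMono e
  nonneg : ∀ n, 0 ≤ e n
  no_accPt : ∀ a : ℝ, ¬ AccPt a (𝓟 (Set.range e))

/-- Jumps occur only between neighbouring states. -/
def IsTridiagonal (Q : Matrix ℕ ℕ ℝ) : Prop :=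
  ∀ x y, Q x y ≠ 0 → y = x ∨ y = x + 1 ∨ x = y + 1

/-- The difference operator `(𝓓 f)(x) = ∑_y q_{x,y} f(y)`. -/
def diffOp (Q : Matrix ℕ ℕ ℝ) (f : ℕ → ℝ) (x : ℕ) : ℝ := ∑' y, Q x y * f y

/-- `𝓓` is well-defined on polynomial functions on `E`, and for every `m` the function `𝓓 x^m`
is a polynomial in `x` of degree at most `m`. -/
def PreservesPolynomials (e : ℕ → ℝ) (Q : Matrix ℕ ℕ ℝ) : Prop :=
  ∀ m : ℕ, (∀ x, Summable fun y => Q x y * e y ^ m) ∧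
    ∃ p : ℝ[X], p.natDegree ≤ m ∧ ∀ x, diffOp Q (fun y => e y ^ m) x = p.eval (e x)

/-- `𝓓^{free} = 𝓓^{[1]} + … + 𝓓^{[N]}`, where `𝓓^{[i]}` is `𝓓` acting on the `i`-th variable. -/
def freeOp {N : ℕ} (Q : Matrix ℕ ℕ ℝ) (f : (Fin N → ℕ) → ℝ) (x : Fin N → ℕ) : ℝ :=
  ∑ i, diffOp Q (fun y => f (Function.update x i y)) (x i)

/-- The Vandermonde product `Δ_N(x) = ∏_{i < j} (x_i - x_j)` on `E^N`. -/
def vandermonde {N : ℕ} (e : ℕ → ℝ) (x : Fin N → ℕ) : ℝ :=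
  ∏ i, ∏ j ∈ Finset.Ioi i, (e (x i) - e (x j))

/-- `E_N`: the tuples `x_1 > x_2 > … > x_N` of elements of `E`. -/
abbrev OrderedTuple (N : ℕ) : Type := {x : Fin N → ℕ // StrictAnti x}

/-- The `h`-transformed matrix `Q^{(N)}`:
`Q^{(N)}(x, y) = Δ_N(y) / Δ_N(x) * ∑_i q_{x_i, y_i} 1_{x_j = y_j for j ≠ i} - c 1_{x = y}`. -/
def hTransform (N : ℕ) (e : ℕ → ℝ) (Q : Matrix ℕ ℕ ℝ) (c : ℝ) :
    Matrix (OrderedTuple N) (OrderedTuple N) ℝ :=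
  fun x y =>
    vandermonde e y.1 / vandermonde e x.1 *
        (∑ i, if ∀ j, j ≠ i → x.1 j = y.1 j then Q (x.1 i) (y.1 i) else 0)
      - if x = y then c else 0

end JumpChain

end

open JumpChain

/-! Everything is reduced to uniqueness for the backward equation $u'=Qu$ on a countable set with
row-finite $Q$. Suppose $W>0$ satisfies $QW\le CW$. By the maximum principle
(`IsBackwardSolution.nonpos`), a solution with zero initial value vanishes if for every
$T,\varepsilon>0$ only finitely many states $i$ have $|u_t(i)|>\varepsilon W(i)$ for some $t\le T$.
When $W$ has finite sublevel sets this covers all bounded solutions.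

The minimal semigroup is a bounded solution in each column, as are its row sums, the two sides of
Chapman-Kolmogorov, and any Markov semigroup whose $q$-matrix is $Q$. Comparing such solutions gives
non-explosion, the semigroup property and uniqueness (`isNonExplosive_of_lyapunov`,
`isUniqueMarkovSemigroup_of_lyapunov`).

For $Q$ itself, preservation of polynomial degree makes every $(1+x)^p$ a Lyapunov function. For
$Q^{(N)}$ one takes $W(\mathbf x)=\sum_k(1+x_k)^{N^2+1}/\Delta_N(\mathbf x)$. Conjugation by
$\Delta_N$ turns $Q^{(N)}+c_N$ into the generator of $N$ independent chains with the jumps out of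
$E_N$ suppressed, so the one-variable bound carries over.

The determinant formula is the Karlin-McGregor argument. Chains with nearest-neighbour jumps can
leave $E_N$ only through a collision, where determinants and $\Delta_N$ vanish. Hence suppressing
those jumps changes nothing for alternating functions, and the right-hand side solves the backward
equation of $Q^{(N)}$ with initial value $I$. It is bounded a priori only by a multiple of
$1/\Delta_N(\mathbf x)$, which need not be bounded since gaps in $E$ may shrink. The denominator in
$W$ and the exponent $N^2+1$ are chosen so that this is still negligible against $W$. -/

noncomputable section

namespace JumpChain

/-! ### Backward equation: maximum principle and stability under bounded limits -/

section General

variable {X : Type*}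

/-- `u` solves the backward equation `u' = Q u` on `[0, ∞)`, where row `i` of `Q` is summed over
the finite set `S i`. -/
def IsBackwardSolution (Q : Matrix X X ℝ) (S : X → Finset X) (u : ℝ → X → ℝ) : Prop :=
  ∀ t, 0 ≤ t → ∀ i,
    HasDerivWithinAt (fun s => u s i) (∑ j ∈ S i, Q i j * u t j) (Set.Ici 0) t

variable {Q : Matrix X X ℝ} {S : X → Finset X}

namespace IsBackwardSolution

theorem continuousOn {u : ℝ → X → ℝ} (hu : IsBackwardSolution Q S u) (i : X) :
    ContinuousOn (fun s => u s i) (Set.Ici 0) :=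
  fun t ht => (hu t ht i).continuousWithinAt

theorem sub {u v : ℝ → X → ℝ} (hu : IsBackwardSolution Q S u) (hv : IsBackwardSolution Q S v) :
    IsBackwardSolution Q S (fun t i => u t i - v t i) := by
  intro t ht i
  exact ((hu t ht i).sub (hv t ht i)).congr_deriv (by simp [mul_sub])

theorem neg {u : ℝ → X → ℝ} (hu : IsBackwardSolution Q S u) :
    IsBackwardSolution Q S (fun t i => - u t i) := by
  intro t ht i
  exact (hu t ht i).neg.congr_deriv (by simp)

theorem sum_mul {ι : Type*} (F : Finset ι) (f : ι → ℝ) {u : ι → ℝ → X → ℝ}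
    (hu : ∀ k, IsBackwardSolution Q S (u k)) :
    IsBackwardSolution Q S (fun t i => ∑ k ∈ F, u k t i * f k) := by
  intro t ht i
  refine (HasDerivWithinAt.fun_sum fun k _ => (hu k t ht i).mul_const (f k)).congr_deriv ?_
  simp only [Finset.mul_sum, Finset.sum_mul]
  rw [Finset.sum_comm]
  simp only [mul_assoc]

theorem comp_add {u : ℝ → X → ℝ} (hu : IsBackwardSolution Q S u) {s : ℝ} (hs : 0 ≤ s) :
    IsBackwardSolution Q S (fun t i => u (t + s) i) := by
  intro t ht i
  have h := hu (t + s) (by positivity) i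
  have h2 : HasDerivWithinAt (fun t : ℝ => t + s) 1 (Set.Ici 0) t :=
    (hasDerivWithinAt_id t _).add_const s
  have := h.scomp t h2 (fun r (hr : 0 ≤ r) => show 0 ≤ r + s by positivity)
  exact this.congr_deriv (by simp)

/-- Maximum principle. -/
theorem nonpos {u : ℝ → X → ℝ} (hu : IsBackwardSolution Q S u)
    (hoff : ∀ i j, i ≠ j → 0 ≤ Q i j) {W : X → ℝ} (hW : ∀ i, 0 < W i) {C : ℝ}
    (hLyap : ∀ i, ∑ j ∈ S i, Q i j * W j ≤ C * W i) (h0 : ∀ i, u 0 i = 0)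
    (hgrowth : ∀ T ε : ℝ, 0 < ε → {i | ∃ t ∈ Set.Icc 0 T, ε * W i < |u t i|}.Finite)
    {T : ℝ} (hT : 0 ≤ T) (x : X) : u T x ≤ 0 := by
  by_contra! hpos
  -- `lam > C` makes the derivative at a positive maximum of `w` strictly negative; `0 ≤ lam` keeps
  -- the factor $e^{-\lambda t}$ at most $1$.
  obtain ⟨lam, hlamC, hlam⟩ : ∃ lam : ℝ, C < lam ∧ 0 ≤ lam :=
    ⟨|C| + 1, by linarith [le_abs_self C], by positivity⟩
  set w : ℝ → X → ℝ := fun t i => Real.exp (-lam * t) * u t i / W i with hw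
  have hwT : 0 < w T x := by have := hW x; simp only [hw]; positivity
  set F := (hgrowth T (w T x / 2) (by positivity)).toFinset with hF
  -- The growth condition confines the supremum of `w` to the finite set `F`, so it is attained at
  -- some `(s, z)` with `s > 0`.
  have hout : ∀ i ∉ F, ∀ t ∈ Set.Icc 0 T, w t i ≤ w T x / 2 := by
    intro i hi t ht
    simp only [hF, Set.Finite.mem_toFinset, Set.mem_ofPred_eq, not_exists, not_and, not_lt] at hi
    have h1 := hi t ht
    have h2 : Real.exp (-lam * t) ≤ 1 := Real.exp_le_one_iff.2 (by nlinarith [ht.1])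
    have h3 : Real.exp (-lam * t) * u t i ≤ |u t i| := by
      calc _ ≤ |Real.exp (-lam * t) * u t i| := le_abs_self _
        _ = Real.exp (-lam * t) * |u t i| := by rw [abs_mul, abs_of_pos (Real.exp_pos _)]
        _ ≤ 1 * |u t i| := by gcongr
        _ = _ := one_mul _
    exact (div_le_iff₀ (hW i)).2 (h3.trans h1)
  have hxF : x ∈ F := by
    by_contra h
    linarith [hout x h T ⟨hT, le_rfl⟩]
  have hcont : ∀ i, ContinuousOn (fun t => w t i) (Set.Icc 0 T) := fun i =>
    (((by fun_prop : Continuous fun t : ℝ => Real.exp (-lam * t)).continuousOn).mul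
      ((hu.continuousOn i).mono Set.Icc_subset_Ici_self)).div_const _
  choose τ hτ hτmax using fun i =>
    isCompact_Icc.exists_isMaxOn (Set.nonempty_Icc.2 hT) (hcont i)
  obtain ⟨z, hzF, hz⟩ := F.exists_max_image (fun i => w (τ i) i) ⟨x, hxF⟩
  set s := τ z with hs
  have hM : w T x ≤ w s z := (hτmax x ⟨hT, le_rfl⟩).trans (hz x hxF)
  have hmax : ∀ i, ∀ t ∈ Set.Icc 0 T, w t i ≤ w s z := by
    intro i t ht
    by_cases hi : i ∈ F
    · exact (hτmax i ht).trans (hz i hi)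
    · linarith [hout i hi t ht]
  have hs0 : 0 < s := by
    rcases (hτ z).1.eq_or_lt with h | h
    · have : w s z = 0 := by simp [hw, hs, ← h, h0]
      linarith
    · exact h
  have hsT : s ≤ T := (hτ z).2
  have hd : HasDerivAt (fun t => w t z)
      ((-lam * Real.exp (-lam * s) * u s z +
        Real.exp (-lam * s) * ∑ j ∈ S z, Q z j * u s j) / W z) s := by
    have h1 := (hu s hs0.le z).hasDerivAt (Ici_mem_nhds hs0)
    have h2 : HasDerivAt (fun t : ℝ => Real.exp (-lam * t)) (-lam * Real.exp (-lam * s)) s := by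
      have := ((hasDerivAt_id s).const_mul (-lam)).exp
      simpa [mul_comm] using this
    exact (h2.mul h1).div_const _
  have hsum : Real.exp (-lam * s) * ∑ j ∈ S z, Q z j * u s j ≤ w s z * (C * W z) := by
    calc _ = ∑ j ∈ S z, Q z j * (w s j * W j) := by
          rw [Finset.mul_sum]
          refine Finset.sum_congr rfl fun j _ => ?_
          have := (hW j).ne'
          simp only [hw]
          field_simp
      _ ≤ ∑ j ∈ S z, Q z j * (w s z * W j) := by
          refine Finset.sum_le_sum fun j _ => ?_
          rcases eq_or_ne z j with rfl | h
          · exact le_rfl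
          · have := hmax j s ⟨hs0.le, hsT⟩
            have := hoff z j h
            have := (hW j).le
            gcongr
      _ = w s z * ∑ j ∈ S z, Q z j * W j := by
          rw [Finset.mul_sum]
          exact Finset.sum_congr rfl fun j _ => by ring
      _ ≤ _ := by
          have : 0 ≤ w s z := by linarith
          have := hLyap z
          gcongr
  have hneg : (-lam * Real.exp (-lam * s) * u s z +
        Real.exp (-lam * s) * ∑ j ∈ S z, Q z j * u s j) / W z < 0 := by
    refine div_neg_of_neg_of_pos ?_ (hW z)
    have h1 : Real.exp (-lam * s) * u s z = w s z * W z := by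
      have := (hW z).ne'
      simp only [hw]
      field_simp
    have h2 : 0 < w s z * W z := mul_pos (by linarith) (hW z)
    nlinarith
  -- A negative derivative at `s` forces larger values just before `s`, contradicting maximality.
  -- Only the left side is used, so `s = T` is allowed.
  have hev : ∀ᶠ t in 𝓝[<] s, w s z < w t z := by
    have h := (hasDerivAt_iff_tendsto_slope.1 hd).mono_left (nhdsLT_le_nhdsNE s)
    filter_upwards [h.eventually (gt_mem_nhds hneg), self_mem_nhdsWithin] with t ht hts
    have hts' : t - s < 0 := sub_neg.2 hts
    rw [slope_def_field] at ht
    by_contra! hle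
    linarith [div_nonneg_of_nonpos (sub_nonpos.2 hle) hts'.le]
  obtain ⟨t, ht, ht1, ht2⟩ := (hev.and (Ioo_mem_nhdsLT hs0)).exists
  linarith [hmax z t ⟨ht1.le, ht2.le.trans hsT⟩]

theorem eq_zero {u : ℝ → X → ℝ} (hu : IsBackwardSolution Q S u)
    (hoff : ∀ i j, i ≠ j → 0 ≤ Q i j) {W : X → ℝ} (hW : ∀ i, 0 < W i) {C : ℝ}
    (hLyap : ∀ i, ∑ j ∈ S i, Q i j * W j ≤ C * W i) (h0 : ∀ i, u 0 i = 0)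
    (hgrowth : ∀ T ε : ℝ, 0 < ε → {i | ∃ t ∈ Set.Icc 0 T, ε * W i < |u t i|}.Finite)
    {T : ℝ} (hT : 0 ≤ T) (x : X) : u T x = 0 := by
  refine le_antisymm (hu.nonpos hoff hW hLyap h0 hgrowth hT x) ?_
  have := hu.neg.nonpos hoff hW hLyap (by simp [h0]) (by simpa using hgrowth) hT x
  linarith

/-- Two bounded solutions with the same initial value agree. -/
theorem eq_of_bounded {u v : ℝ → X → ℝ} (hu : IsBackwardSolution Q S u)
    (hv : IsBackwardSolution Q S v)
    (hoff : ∀ i j, i ≠ j → 0 ≤ Q i j) {W : X → ℝ} (hW : ∀ i, 0 < W i) {C : ℝ}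
    (hLyap : ∀ i, ∑ j ∈ S i, Q i j * W j ≤ C * W i) (hfin : ∀ R, {i | W i ≤ R}.Finite)
    (h0 : ∀ i, u 0 i = v 0 i) (hub : ∀ t, 0 ≤ t → ∀ i, |u t i| ≤ 1)
    (hvb : ∀ t, 0 ≤ t → ∀ i, |v t i| ≤ 1)
    {T : ℝ} (hT : 0 ≤ T) (x : X) : u T x = v T x := by
  refine sub_eq_zero.1 ((hu.sub hv).eq_zero hoff hW hLyap (by simp [h0]) ?_ hT x)
  intro T ε hε
  refine (hfin (2 / ε)).subset ?_
  rintro i ⟨t, ht, h⟩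
  have := abs_sub (u t i) (v t i)
  have := hub t ht.1 i
  have := hvb t ht.1 i
  rw [Set.mem_ofPred_eq, le_div_iff₀ hε]
  linarith

end IsBackwardSolution

variable [DecidableEq X]

theorem sum_eq_diag_add (hS : ∀ i j, j ∉ S i → Q i j = 0) (f : X → ℝ) (i : X) :
    ∑ j ∈ S i, Q i j * f j = Q i i * f i + ∑ j ∈ S i, if j = i then 0 else Q i j * f j := by
  have h : ∀ j ∈ S i, Q i j * f j =
      (if j = i then Q i i * f i else 0) + if j = i then 0 else Q i j * f j := by
    intro j _
    split_ifs with h <;> simp [h]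
  rw [Finset.sum_congr rfl h, Finset.sum_add_distrib, Finset.sum_ite_eq']
  by_cases hi : i ∈ S i
  · simp [hi]
  · simp [hi, hS i i hi]

theorem IsRateMatrix.sum_eq_zero (hQ : IsRateMatrix Q) (hS : ∀ i j, j ∉ S i → Q i j = 0) (i : X) :
    ∑ j ∈ S i, Q i j = 0 := by
  have h := sum_eq_diag_add hS (fun _ => 1) i
  simp only [mul_one] at h
  have h2 := (hQ.conservative i).unique (hasSum_sum_of_ne_finset_zero (s := S i) (fun j hj => by
    simp [hS i j hj]))
  rw [h, ← h2]
  ring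

/-- Bounded pointwise limits of approximate solutions solve the backward equation. -/
theorem IsBackwardSolution.of_tendsto {ι : Type*} {l : Filter ι} [l.IsCountablyGenerated]
    [l.NeBot] (hS : ∀ i j, j ∉ S i → Q i j = 0) {u v : ι → ℝ → X → ℝ} {w : ℝ → X → ℝ}
    (hderiv : ∀ m t, 0 ≤ t → ∀ i, HasDerivWithinAt (fun s => u m s i)
      (Q i i * u m t i + ∑ j ∈ S i, if j = i then 0 else Q i j * v m t j) (Set.Ici 0) t)
    (hub : ∀ m t, 0 ≤ t → ∀ i, |u m t i| ≤ 1) (hvb : ∀ m t, 0 ≤ t → ∀ i, |v m t i| ≤ 1)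
    (hvc : ∀ m i, ContinuousOn (fun t => v m t i) (Set.Ici 0))
    (hu : ∀ t, 0 ≤ t → ∀ i, Tendsto (fun m => u m t i) l (𝓝 (w t i)))
    (hv : ∀ t, 0 ≤ t → ∀ i, Tendsto (fun m => v m t i) l (𝓝 (w t i))) :
    IsBackwardSolution Q S w := by
  set K : X → ℝ := fun i => |Q i i| + ∑ j ∈ S i, |Q i j| with hK
  set D : ι → ℝ → X → ℝ := fun m t i =>
    Q i i * u m t i + ∑ j ∈ S i, if j = i then 0 else Q i j * v m t j with hD
  have hbound : ∀ m t, 0 ≤ t → ∀ i, ‖D m t i‖ ≤ K i := by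
    intro m t ht i
    refine (norm_add_le _ _).trans (add_le_add ?_ ((norm_sum_le _ _).trans
      (Finset.sum_le_sum fun j _ => ?_)))
    · rw [norm_mul, Real.norm_eq_abs, Real.norm_eq_abs]
      exact mul_le_of_le_one_right (abs_nonneg _) (hub m t ht i)
    · split_ifs
      · simp
      · rw [norm_mul, Real.norm_eq_abs, Real.norm_eq_abs]
        exact mul_le_of_le_one_right (abs_nonneg _) (hvb m t ht j)
  have huc : ∀ m i, ContinuousOn (fun t => u m t i) (Set.Ici 0) := fun m i t ht =>
    (hderiv m t ht i).continuousWithinAt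
  have hDc : ∀ m i, ContinuousOn (fun t => D m t i) (Set.Ici 0) := by
    intro m i
    refine (continuousOn_const.mul (huc m i)).add (continuousOn_finsetSum _ fun j _ => ?_)
    split_ifs
    · exact continuousOn_const
    · exact continuousOn_const.mul (hvc m j)
  -- The derivatives are bounded by `K i` for all `m`, so the Lipschitz bound passes to the
  -- pointwise limit. Dominated convergence then gives the integral form of the equation, which is
  -- differentiated.
  have hwc : ∀ i, ContinuousOn (fun t => w t i) (Set.Ici 0) := by
    intro i
    have : LipschitzOnWith (K i).toNNReal (fun t => w t i) (Set.Ici 0) := by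
      refine LipschitzOnWith.of_dist_le_mul fun s hs t ht => ?_
      rw [Real.coe_toNNReal _ (by positivity), Real.dist_eq, Real.dist_eq]
      refine le_of_tendsto ((hu s hs i).sub (hu t ht i)).abs (Eventually.of_forall fun m => ?_)
      exact (convex_Ici 0).norm_image_sub_le_of_norm_hasDerivWithin_le
        (fun r hr => hderiv m r hr i) (fun r hr => hbound m r hr i) ht hs
    exact this.continuousOn
  set g : X → ℝ → ℝ := fun i s => ∑ j ∈ S i, Q i j * w (max s 0) j with hg
  have hgc : ∀ i, Continuous (g i) := fun i => continuous_finsetSum _ fun j _ =>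
    continuous_const.mul
      ((hwc j).comp_continuous (by fun_prop) fun s => Set.mem_Ici.2 (le_max_right _ _))
  have hint : ∀ t, 0 ≤ t → ∀ i, w t i = w 0 i + ∫ s in (0 : ℝ)..t, g i s := by
    intro t ht i
    have h1 : ∀ m, ∫ s in (0 : ℝ)..t, D m s i = u m t i - u m 0 i := by
      intro m
      refine intervalIntegral.integral_eq_sub_of_hasDeriv_right_of_le ht
        ((huc m i).mono Set.Icc_subset_Ici_self) (fun s hs => ?_) ?_
      · exact (hderiv m s hs.1.le i).mono fun r hr => hs.1.le.trans (le_of_lt hr)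
      · refine ((hDc m i).mono ?_).intervalIntegrable
        rw [Set.uIcc_of_le ht]
        exact Set.Icc_subset_Ici_self
    have h2 : Tendsto (fun m => ∫ s in (0 : ℝ)..t, D m s i) l (𝓝 (∫ s in (0 : ℝ)..t, g i s)) := by
      refine intervalIntegral.tendsto_integral_filter_of_dominated_convergence (fun _ => K i)
        (Eventually.of_forall fun m => ?_) (Eventually.of_forall fun m => ?_) (by simp) ?_
      · refine ((hDc m i).mono ?_).aestronglyMeasurable measurableSet_uIoc
        rw [Set.uIoc_of_le ht]
        exact fun s hs => hs.1.le
      · refine Eventually.of_forall fun s hs => hbound m s ?_ i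
        rw [Set.uIoc_of_le ht] at hs
        exact hs.1.le
      · refine Eventually.of_forall fun s hs => ?_
        rw [Set.uIoc_of_le ht] at hs
        have hs0 : 0 ≤ s := hs.1.le
        simp only [hg, hD, max_eq_left hs0]
        rw [sum_eq_diag_add hS]
        refine ((hu s hs0 i).const_mul _).add (tendsto_finsetSum _ fun j _ => ?_)
        split_ifs
        · exact tendsto_const_nhds
        · exact (hv s hs0 j).const_mul _
    have h3 := tendsto_nhds_unique h2 (((hu t ht i).sub (hu 0 le_rfl i)).congr fun m => (h1 m).symm)
    linarith
  intro t ht i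
  have hd : HasDerivAt (fun r => w 0 i + ∫ s in (0 : ℝ)..r, g i s) (g i t) t :=
    ((hgc i).integral_hasStrictDerivAt 0 t).hasDerivAt.const_add _
  have := hd.hasDerivWithinAt.congr (s := Set.Ici 0) (fun r hr => hint r hr i) (hint t ht i)
  simpa [hg, max_eq_left ht] using this

end General

/-! ### The minimal semigroup: jump expansion, sub-stochasticity, backward equation -/

section Minimal

variable {X : Type*} [DecidableEq X] {Q : Matrix X X ℝ} {S : X → Finset X}

/-- The substitution $r=t-s$ removes $t$ from the integrand, so the fundamental theorem of calculus
applies. -/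
theorem jumpTerm_succ (hS : ∀ i j, j ∉ S i → Q i j = 0) (n : ℕ) (t : ℝ) (i j : X) :
    jumpTerm Q (n + 1) t i j = Real.exp (Q i i * t) * ∫ r in (0 : ℝ)..t,
      Real.exp (-Q i i * r) * ∑ k ∈ S i, if k = i then 0 else Q i k * jumpTerm Q n r k j := by
  have h : ∀ s, Real.exp (Q i i * s) *
      (∑' k, if k = i then 0 else Q i k * jumpTerm Q n (t - s) k j) =
      (fun r => Real.exp (Q i i * t) * (Real.exp (-Q i i * r) *
        ∑ k ∈ S i, if k = i then 0 else Q i k * jumpTerm Q n r k j)) (t - s) := by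
    intro s
    rw [tsum_eq_sum (s := S i) fun k hk => by simp [hS i k hk]]
    simp only [← mul_assoc, ← Real.exp_add]
    ring_nf
  refine (intervalIntegral.integral_congr fun s _ => h s).trans ?_
  refine (intervalIntegral.integral_comp_sub_left (fun r => Real.exp (Q i i * t) *
    (Real.exp (-Q i i * r) * ∑ k ∈ S i, if k = i then 0 else Q i k * jumpTerm Q n r k j)) t).trans ?_
  rw [sub_self, sub_zero, intervalIntegral.integral_const_mul]

theorem continuous_jumpTerm (hS : ∀ i j, j ∉ S i → Q i j = 0) (n : ℕ) (i j : X) :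
    Continuous fun t => jumpTerm Q n t i j := by
  induction n generalizing i with
  | zero =>
    simp only [jumpTerm]
    split_ifs <;> fun_prop
  | succ n ih =>
    simp only [jumpTerm_succ hS]
    refine (by fun_prop : Continuous fun t : ℝ => Real.exp (Q i i * t)).mul
      (intervalIntegral.continuous_primitive (fun a b => Continuous.intervalIntegrable ?_ a b) 0)
    refine (by fun_prop : Continuous fun t : ℝ => Real.exp (-Q i i * t)).mul
      (continuous_finsetSum _ fun k _ => ?_)
    split_ifs
    · exact continuous_const
    · exact continuous_const.mul (ih k)

theorem hasDerivAt_exp_mul (a t : ℝ) :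
    HasDerivAt (fun t : ℝ => Real.exp (a * t)) (a * Real.exp (a * t)) t := by
  have := ((hasDerivAt_id t).const_mul a).exp
  simpa [mul_comm] using this

theorem hasDerivAt_jumpTerm_zero (t : ℝ) (i j : X) :
    HasDerivAt (fun t => jumpTerm Q 0 t i j) (Q i i * jumpTerm Q 0 t i j) t := by
  simp only [jumpTerm]
  split_ifs
  · exact hasDerivAt_exp_mul _ _
  · simpa using hasDerivAt_const t (0 : ℝ)

theorem hasDerivAt_jumpTerm_succ (hS : ∀ i j, j ∉ S i → Q i j = 0) (n : ℕ) (t : ℝ) (i j : X) :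
    HasDerivAt (fun t => jumpTerm Q (n + 1) t i j) (Q i i * jumpTerm Q (n + 1) t i j +
      ∑ k ∈ S i, if k = i then 0 else Q i k * jumpTerm Q n t k j) t := by
  simp only [jumpTerm_succ hS]
  have hc : Continuous fun r : ℝ => Real.exp (-Q i i * r) *
      ∑ k ∈ S i, if k = i then 0 else Q i k * jumpTerm Q n r k j := by
    refine (by fun_prop : Continuous fun t : ℝ => Real.exp (-Q i i * t)).mul
      (continuous_finsetSum _ fun k _ => ?_)
    split_ifs
    · exact continuous_const
    · exact continuous_const.mul (continuous_jumpTerm hS n k j)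
  refine ((hasDerivAt_exp_mul (Q i i) t).mul
    (hc.integral_hasStrictDerivAt 0 t).hasDerivAt).congr_deriv ?_
  rw [mul_assoc, ← mul_assoc (Real.exp (Q i i * t)), ← Real.exp_add]
  simp

theorem jumpTerm_nonneg (hQ : IsRateMatrix Q) (n : ℕ) {t : ℝ} (ht : 0 ≤ t) (i j : X) :
    0 ≤ jumpTerm Q n t i j := by
  induction n generalizing t i with
  | zero =>
    simp only [jumpTerm]
    split_ifs <;> positivity
  | succ n ih =>
    simp only [jumpTerm]
    refine intervalIntegral.integral_nonneg ht fun s hs =>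
      mul_nonneg (Real.exp_pos _).le (tsum_nonneg fun k => ?_)
    split_ifs with h
    · exact le_rfl
    · exact mul_nonneg (hQ.nonneg i k (Ne.symm h)) (ih (by linarith [hs.2]) k)

/-- The probability of at most `m - 1` jumps, ending in `j`. -/
def partialSum (Q : Matrix X X ℝ) (m : ℕ) (t : ℝ) : Matrix X X ℝ :=
  fun i j => ∑ n ∈ Finset.range m, jumpTerm Q n t i j

theorem continuous_partialSum (hS : ∀ i j, j ∉ S i → Q i j = 0) (m : ℕ) (i j : X) :
    Continuous fun t => partialSum Q m t i j :=
  continuous_finsetSum _ fun n _ => continuous_jumpTerm hS n i j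

theorem partialSum_nonneg (hQ : IsRateMatrix Q) (m : ℕ) {t : ℝ} (ht : 0 ≤ t) (i j : X) :
    0 ≤ partialSum Q m t i j :=
  Finset.sum_nonneg fun n _ => jumpTerm_nonneg hQ n ht i j

/-- The first jump uses up one of the allowed jumps, hence the lag between `m + 1` and `m`. This is
why `IsBackwardSolution.of_tendsto` takes two families `u` and `v` with a common limit. -/
theorem hasDerivAt_partialSum (hS : ∀ i j, j ∉ S i → Q i j = 0) (m : ℕ) (t : ℝ) (i j : X) :
    HasDerivAt (fun t => partialSum Q (m + 1) t i j) (Q i i * partialSum Q (m + 1) t i j +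
      ∑ k ∈ S i, if k = i then 0 else Q i k * partialSum Q m t k j) t := by
  simp only [partialSum, Finset.sum_range_succ' _ m]
  refine ((HasDerivAt.fun_sum fun n _ => hasDerivAt_jumpTerm_succ hS n t i j).add
    (hasDerivAt_jumpTerm_zero t i j)).congr_deriv ?_
  rw [Finset.sum_add_distrib, Finset.sum_comm, ← Finset.mul_sum]
  have : ∀ k, (∑ n ∈ Finset.range m, if k = i then 0 else Q i k * jumpTerm Q n t k j) =
      if k = i then 0 else Q i k * ∑ n ∈ Finset.range m, jumpTerm Q n t k j := by
    intro k
    split_ifs <;> simp [Finset.mul_sum]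
  simp only [this]
  ring

theorem jumpTerm_at_zero (n : ℕ) (i j : X) :
    jumpTerm Q n 0 i j = if n = 0 then (1 : Matrix X X ℝ) i j else 0 := by
  cases n <;> simp [jumpTerm, Matrix.one_apply]

theorem partialSum_at_zero (m : ℕ) (i j : X) :
    partialSum Q m 0 i j = if m = 0 then 0 else (1 : Matrix X X ℝ) i j := by
  cases m <;> simp [partialSum, jumpTerm_at_zero]

/-- By induction the off-diagonal contribution to `A'` is at most $q_i$, so $e^{q_it}(A(t)-1)$ is
nonincreasing; it starts at a value $\le 0$. -/
theorem sum_partialSum_le_one (hQ : IsRateMatrix Q) (hS : ∀ i j, j ∉ S i → Q i j = 0)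
    (F : Finset X) (m : ℕ) {t : ℝ} (ht : 0 ≤ t) (i : X) :
    ∑ j ∈ F, partialSum Q m t i j ≤ 1 := by
  induction m generalizing t i with
  | zero => simp [partialSum]
  | succ m ih =>
    set A : ℝ → ℝ := fun t => ∑ j ∈ F, partialSum Q (m + 1) t i j with hA
    have hd : ∀ t, HasDerivAt A (Q i i * A t + ∑ k ∈ S i, if k = i then 0 else
        Q i k * ∑ j ∈ F, partialSum Q m t k j) t := by
      intro t
      refine (HasDerivAt.fun_sum fun j _ => hasDerivAt_partialSum hS m t i j).congr_deriv ?_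
      rw [Finset.sum_add_distrib, Finset.sum_comm, ← Finset.mul_sum]
      congr 1
      refine Finset.sum_congr rfl fun k _ => ?_
      split_ifs <;> simp [Finset.mul_sum]
    have hle : ∀ t, 0 ≤ t → (∑ k ∈ S i, if k = i then 0 else
        Q i k * ∑ j ∈ F, partialSum Q m t k j) ≤ - Q i i := by
      intro t ht
      have h := sum_eq_diag_add hS (fun _ => 1) i
      simp only [mul_one] at h
      rw [hQ.sum_eq_zero hS] at h
      rw [eq_neg_of_add_eq_zero_left h.symm, neg_neg]
      refine Finset.sum_le_sum fun k _ => ?_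
      split_ifs with hk
      · exact le_rfl
      · exact mul_le_of_le_one_right (hQ.nonneg i k (Ne.symm hk)) (ih ht k)
    have hd2 : ∀ t, HasDerivAt (fun t => Real.exp (-Q i i * t) * (A t - 1))
        (Real.exp (-Q i i * t) * (Q i i + ∑ k ∈ S i, if k = i then 0 else
        Q i k * ∑ j ∈ F, partialSum Q m t k j)) t := by
      intro t
      refine ((hasDerivAt_exp_mul (-Q i i) t).mul ((hd t).sub_const 1)).congr_deriv ?_
      ring
    have hanti : AntitoneOn (fun t => Real.exp (-Q i i * t) * (A t - 1)) (Set.Ici 0) := by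
      refine antitoneOn_of_deriv_nonpos (convex_Ici 0)
        (fun t _ => (hd2 t).continuousAt.continuousWithinAt)
        (fun t _ => (hd2 t).differentiableAt.differentiableWithinAt) fun t h => ?_
      rw [interior_Ici] at h
      rw [(hd2 t).deriv]
      exact mul_nonpos_of_nonneg_of_nonpos (Real.exp_pos _).le (by linarith [hle t (le_of_lt h)])
    have h1 := hanti (Set.mem_Ici.2 le_rfl) (Set.mem_Ici.2 ht) ht
    have h0 : A 0 ≤ 1 := by
      simp only [hA, partialSum_at_zero, Nat.add_eq_zero_iff, one_ne_zero, and_false, if_false,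
        Matrix.one_apply, Finset.sum_ite_eq]
      split_ifs <;> norm_num
    have h2 : Real.exp (-Q i i * t) * (A t - 1) ≤ 0 := by
      refine h1.trans ?_
      simp only [mul_zero, Real.exp_zero, one_mul]
      linarith
    have := nonpos_of_mul_nonpos_right h2 (Real.exp_pos _)
    linarith

theorem partialSum_le_one (hQ : IsRateMatrix Q) (hS : ∀ i j, j ∉ S i → Q i j = 0)
    (m : ℕ) {t : ℝ} (ht : 0 ≤ t) (i j : X) : partialSum Q m t i j ≤ 1 := by
  simpa using sum_partialSum_le_one hQ hS {j} m ht i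

theorem hasSum_jumpTerm (hQ : IsRateMatrix Q) (hS : ∀ i j, j ∉ S i → Q i j = 0)
    {t : ℝ} (ht : 0 ≤ t) (i j : X) :
    HasSum (fun n => jumpTerm Q n t i j) (minimalSemigroup Q t i j) :=
  (summable_of_sum_range_le (fun n => jumpTerm_nonneg hQ n ht i j)
    (fun m => partialSum_le_one hQ hS m ht i j)).hasSum

theorem minimalSemigroup_nonneg (hQ : IsRateMatrix Q) {t : ℝ} (ht : 0 ≤ t) (i j : X) :
    0 ≤ minimalSemigroup Q t i j :=
  tsum_nonneg fun n => jumpTerm_nonneg hQ n ht i j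

theorem minimalSemigroup_zero (i j : X) :
    minimalSemigroup Q 0 i j = (1 : Matrix X X ℝ) i j := by
  simp [minimalSemigroup, jumpTerm_at_zero]

theorem tendsto_partialSum (hQ : IsRateMatrix Q) (hS : ∀ i j, j ∉ S i → Q i j = 0)
    {t : ℝ} (ht : 0 ≤ t) (i j : X) :
    Tendsto (fun m => partialSum Q m t i j) atTop (𝓝 (minimalSemigroup Q t i j)) :=
  (hasSum_jumpTerm hQ hS ht i j).tendsto_sum_nat

theorem sum_minimalSemigroup_le_one (hQ : IsRateMatrix Q) (hS : ∀ i j, j ∉ S i → Q i j = 0)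
    (F : Finset X) {t : ℝ} (ht : 0 ≤ t) (i : X) :
    ∑ j ∈ F, minimalSemigroup Q t i j ≤ 1 :=
  le_of_tendsto (tendsto_finsetSum _ fun j _ => tendsto_partialSum hQ hS ht i j)
    (Eventually.of_forall fun m => sum_partialSum_le_one hQ hS F m ht i)

theorem abs_minimalSemigroup_le_one (hQ : IsRateMatrix Q) (hS : ∀ i j, j ∉ S i → Q i j = 0)
    {t : ℝ} (ht : 0 ≤ t) (i j : X) : |minimalSemigroup Q t i j| ≤ 1 := by
  rw [abs_of_nonneg (minimalSemigroup_nonneg hQ ht i j)]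
  simpa using sum_minimalSemigroup_le_one hQ hS {j} ht i

theorem isBackwardSolution_minimalSemigroup (hQ : IsRateMatrix Q)
    (hS : ∀ i j, j ∉ S i → Q i j = 0) (j : X) :
    IsBackwardSolution Q S (fun t i => minimalSemigroup Q t i j) := by
  have hb : ∀ m t, 0 ≤ t → ∀ i, |partialSum Q m t i j| ≤ 1 := fun m t ht i => by
    rw [abs_of_nonneg (partialSum_nonneg hQ m ht i j)]
    exact partialSum_le_one hQ hS m ht i j
  exact IsBackwardSolution.of_tendsto (l := atTop) hS (u := fun m t i => partialSum Q (m + 1) t i j)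
    (v := fun m t i => partialSum Q m t i j)
    (fun m t _ i => (hasDerivAt_partialSum hS m t i j).hasDerivWithinAt)
    (fun m => hb (m + 1)) hb (fun m i => (continuous_partialSum hS m i j).continuousOn)
    (fun t ht i => (tendsto_partialSum hQ hS ht i j).comp (tendsto_add_atTop_nat 1))
    (fun t ht i => tendsto_partialSum hQ hS ht i j)

theorem summable_minimalSemigroup (hQ : IsRateMatrix Q) (hS : ∀ i j, j ∉ S i → Q i j = 0)
    {t : ℝ} (ht : 0 ≤ t) (i : X) : Summable fun j => minimalSemigroup Q t i j :=
  summable_of_sum_le (fun j => minimalSemigroup_nonneg hQ ht i j)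
    (fun F => sum_minimalSemigroup_le_one hQ hS F ht i)

theorem abs_sum_minimalSemigroup_mul_le (hQ : IsRateMatrix Q) (hS : ∀ i j, j ∉ S i → Q i j = 0)
    {f : X → ℝ} (hf : ∀ k, |f k| ≤ 1) (F : Finset X) {t : ℝ} (ht : 0 ≤ t) (i : X) :
    |∑ k ∈ F, minimalSemigroup Q t i k * f k| ≤ 1 := by
  refine (Finset.abs_sum_le_sum_abs _ _).trans
    ((Finset.sum_le_sum fun k _ => ?_).trans (sum_minimalSemigroup_le_one hQ hS F ht i))
  rw [abs_mul, abs_of_nonneg (minimalSemigroup_nonneg hQ ht i k)]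
  exact mul_le_of_le_one_right (minimalSemigroup_nonneg hQ ht i k) (hf k)

theorem summable_minimalSemigroup_mul (hQ : IsRateMatrix Q) (hS : ∀ i j, j ∉ S i → Q i j = 0)
    {f : X → ℝ} (hf : ∀ k, |f k| ≤ 1) {t : ℝ} (ht : 0 ≤ t) (i : X) :
    Summable fun k => minimalSemigroup Q t i k * f k := by
  refine Summable.of_norm_bounded (summable_minimalSemigroup hQ hS ht i) fun k => ?_
  rw [norm_mul, Real.norm_eq_abs, Real.norm_eq_abs,
    abs_of_nonneg (minimalSemigroup_nonneg hQ ht i k)]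
  exact mul_le_of_le_one_right (minimalSemigroup_nonneg hQ ht i k) (hf k)

theorem abs_tsum_minimalSemigroup_mul_le (hQ : IsRateMatrix Q) (hS : ∀ i j, j ∉ S i → Q i j = 0)
    {f : X → ℝ} (hf : ∀ k, |f k| ≤ 1) {t : ℝ} (ht : 0 ≤ t) (i : X) :
    |∑' k, minimalSemigroup Q t i k * f k| ≤ 1 :=
  le_of_tendsto (summable_minimalSemigroup_mul hQ hS hf ht i).hasSum.abs
    (Eventually.of_forall fun F => abs_sum_minimalSemigroup_mul_le hQ hS hf F ht i)

/-- Finite partial sums are solutions bounded by $1$, and the bound survives the limit. Countability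
of `X` makes `atTop` on finite subsets countably generated, as dominated convergence requires. -/
theorem isBackwardSolution_tsum_minimalSemigroup_mul [Countable X] (hQ : IsRateMatrix Q)
    (hS : ∀ i j, j ∉ S i → Q i j = 0) {f : X → ℝ} (hf : ∀ k, |f k| ≤ 1) :
    IsBackwardSolution Q S (fun t i => ∑' k, minimalSemigroup Q t i k * f k) := by
  have hsol : ∀ F : Finset X,
      IsBackwardSolution Q S (fun t i => ∑ k ∈ F, minimalSemigroup Q t i k * f k) := fun F =>
    IsBackwardSolution.sum_mul F f fun k => isBackwardSolution_minimalSemigroup hQ hS k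
  have hlim : ∀ t, 0 ≤ t → ∀ i, Tendsto (fun F : Finset X =>
      ∑ k ∈ F, minimalSemigroup Q t i k * f k) atTop
      (𝓝 (∑' k, minimalSemigroup Q t i k * f k)) := fun t ht i =>
    (summable_minimalSemigroup_mul hQ hS hf ht i).hasSum
  refine IsBackwardSolution.of_tendsto (l := (atTop : Filter (Finset X))) hS
    (u := fun F t i => ∑ k ∈ F, minimalSemigroup Q t i k * f k)
    (v := fun F t i => ∑ k ∈ F, minimalSemigroup Q t i k * f k)
    (fun F t ht i => ?_) (fun F t ht i => abs_sum_minimalSemigroup_mul_le hQ hS hf F ht i)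
    (fun F t ht i => abs_sum_minimalSemigroup_mul_le hQ hS hf F ht i)
    (fun F i => (hsol F).continuousOn i) hlim hlim
  exact (hsol F t ht i).congr_deriv (sum_eq_diag_add hS _ i)

end Minimal

/-! ### Markov semigroups solve the backward equation; existence and uniqueness from a Lyapunov
function -/

section Semigroup

/-- Uniformity in the base point upgrades right increments to a full derivative: for `s < t` the
estimate is applied at base `s`, and continuity of `g` replaces `g s` by `g t`. -/
theorem hasDerivWithinAt_Ici_of_uniform {u g : ℝ → ℝ} (hg : ContinuousOn g (Set.Ici 0))
    (h : ∀ ε > 0, ∃ δ > 0, ∀ t, 0 ≤ t → ∀ r, 0 < r → r < δ →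
      |u (t + r) - u t - r * g t| ≤ ε * r) {t : ℝ} (ht : 0 ≤ t) :
    HasDerivWithinAt u (g t) (Set.Ici 0) t := by
  rw [hasDerivWithinAt_iff_isLittleO, Asymptotics.isLittleO_iff]
  intro ε hε
  obtain ⟨δ, hδ, H⟩ := h (ε / 2) (by positivity)
  have h1 : ∀ᶠ s in 𝓝[Set.Ici 0] t, |g s - g t| < ε / 2 :=
    (Metric.continuousWithinAt_iff'.1 (hg t ht)) (ε / 2) (by positivity)
  have h2 : ∀ᶠ s in 𝓝[Set.Ici 0] t, |s - t| < δ :=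
    mem_nhdsWithin_of_mem_nhds (Metric.ball_mem_nhds t hδ)
  filter_upwards [h1, h2, self_mem_nhdsWithin] with s hs1 hs2 hs3
  rw [Real.norm_eq_abs, Real.norm_eq_abs, smul_eq_mul]
  rcases lt_trichotomy s t with hlt | rfl | hlt
  · rw [abs_of_neg (sub_neg.2 hlt)] at hs2 ⊢
    have h3 := H s hs3 (t - s) (by linarith) (by linarith)
    rw [add_sub_cancel] at h3
    have h4 : u s - u t - (s - t) * g t =
        -(u t - u s - (t - s) * g s) - (t - s) * (g s - g t) := by ring
    have h5 : |(t - s) * (g s - g t)| ≤ (t - s) * (ε / 2) := by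
      rw [abs_mul, abs_of_pos (sub_pos.2 hlt)]
      exact mul_le_mul_of_nonneg_left hs1.le (by linarith)
    rw [h4]
    refine (abs_sub _ _).trans ?_
    rw [abs_neg]
    linarith
  · simp
  · rw [abs_of_pos (sub_pos.2 hlt)] at hs2 ⊢
    have h3 := H t ht (s - t) (by linarith) hs2
    rw [add_sub_cancel] at h3
    refine h3.trans (mul_le_mul_of_nonneg_right (by linarith) (by linarith))

theorem continuousOn_Ici_of_uniform {u g : ℝ → ℝ} {K : ℝ} (hg : ∀ t, 0 ≤ t → |g t| ≤ K)
    (h : ∀ ε > 0, ∃ δ > 0, ∀ t, 0 ≤ t → ∀ r, 0 < r → r < δ →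
      |u (t + r) - u t - r * g t| ≤ ε * r) : ContinuousOn u (Set.Ici 0) := by
  have hK : 0 ≤ K := (abs_nonneg _).trans (hg 0 le_rfl)
  obtain ⟨δ, hδ, H⟩ := h 1 one_pos
  have key : ∀ t, 0 ≤ t → ∀ r, 0 ≤ r → r < δ → |u (t + r) - u t| ≤ (1 + K) * r := by
    intro t ht r hr hrδ
    rcases hr.eq_or_lt with rfl | hr
    · simp
    have h1 := H t ht r hr hrδ
    have h2 : |r * g t| ≤ r * K := by
      rw [abs_mul, abs_of_pos hr]
      exact mul_le_mul_of_nonneg_left (hg t ht) hr.le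
    have h3 := abs_add_le (u (t + r) - u t - r * g t) (r * g t)
    rw [sub_add_cancel] at h3
    linarith
  intro t ht
  rw [Metric.continuousWithinAt_iff]
  intro ε hε
  refine ⟨min δ (ε / (1 + K)), by positivity, fun s hs hst => ?_⟩
  rw [Real.dist_eq] at hst ⊢
  have h1 := hst.trans_le (min_le_left _ _)
  have h2 := hst.trans_le (min_le_right _ _)
  rw [lt_div_iff₀' (by positivity)] at h2
  rcases le_total t s with hle | hle
  · rw [abs_of_nonneg (sub_nonneg.2 hle)] at h1 h2
    have := key t ht (s - t) (by linarith) h1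
    rw [add_sub_cancel] at this
    linarith
  · rw [abs_sub_comm, abs_of_nonneg (sub_nonneg.2 hle)] at h1 h2
    have := key s hs (t - s) (by linarith) h1
    rw [add_sub_cancel, abs_sub_comm] at this
    linarith

variable {X : Type*} [DecidableEq X] {Q : Matrix X X ℝ} {S : X → Finset X}

theorem IsMarkovSemigroup.abs_le_one {P : ℝ≥0 → Matrix X X ℝ} (hP : IsMarkovSemigroup P)
    (t : ℝ≥0) (i j : X) : |P t i j| ≤ 1 := by
  rw [abs_of_nonneg ((hP.stochastic t).nonneg i j)]
  exact le_hasSum ((hP.stochastic t).row_sum i) j fun k _ => (hP.stochastic t).nonneg i k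

/-- A stochastic row applied to a bounded function: the error of replacing `P - 1` by `h • Q`
is controlled by the error on the support of row `i` of `Q`. -/
theorem IsMarkovSemigroup.abs_sub_sub_le {P : ℝ≥0 → Matrix X X ℝ} (hP : IsMarkovSemigroup P)
    (hQ : IsRateMatrix Q) (hS : ∀ i j, j ∉ S i → Q i j = 0) (t h : ℝ≥0) (i j : X) :
    |P (h + t) i j - P t i j - h * ∑ k ∈ S i, Q i k * P t k j| ≤
      2 * ∑ k ∈ insert i (S i), |P h i k - (1 : Matrix X X ℝ) i k - h * Q i k| := by
  -- `S i` need not contain `i`, but the identity matrix contributes there.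
  set S' := insert i (S i) with hS'
  set d : X → ℝ := fun k => P h i k - (1 : Matrix X X ℝ) i k - h * Q i k with hd
  have hext : ∀ f : X → ℝ, ∑ k ∈ S i, Q i k * f k = ∑ k ∈ S', Q i k * f k := fun f =>
    Finset.sum_subset (Finset.subset_insert _ _) fun k _ hk => by simp [hS i k hk]
  have hone : ∀ f : X → ℝ, ∑ k ∈ S', (1 : Matrix X X ℝ) i k * f k = f i := by
    intro f
    simp [Matrix.one_apply, hS']
  have hrow := (hP.stochastic h).row_sum i
  have hck := hP.chapman_kolmogorov h t i j
  have h1 : HasSum (fun k => if k ∈ S' then 0 else P h i k * P t k j)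
      (P (h + t) i j - ∑ k ∈ S', P h i k * P t k j) := by
    have := hck.sub (hasSum_sum_of_ne_finset_zero (s := S')
      (f := fun k => if k ∈ S' then P h i k * P t k j else 0) (fun k hk => if_neg hk))
    rw [Finset.sum_congr rfl fun k hk => if_pos hk] at this
    refine this.congr_fun fun k => ?_
    split_ifs <;> simp
  have h2 : HasSum (fun k => if k ∈ S' then 0 else P h i k) (1 - ∑ k ∈ S', P h i k) := by
    have := hrow.sub (hasSum_sum_of_ne_finset_zero (s := S')
      (f := fun k => if k ∈ S' then P h i k else 0) (fun k hk => if_neg hk))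
    rw [Finset.sum_congr rfl fun k hk => if_pos hk] at this
    refine this.congr_fun fun k => ?_
    split_ifs <;> simp
  -- The infinite tail is at most the mass that row `i` of `P h` puts outside `S'`. As the rows of
  -- $I$ and $Q$ sum to $1$ and $0$ over `S'`, that mass is `-∑ d`, again an error on finitely many
  -- entries.
  have h3 : |P (h + t) i j - ∑ k ∈ S', P h i k * P t k j| ≤ 1 - ∑ k ∈ S', P h i k := by
    rw [abs_of_nonneg (h1.nonneg fun k => ?_)]
    · refine hasSum_le (fun k => ?_) h1 h2
      split_ifs
      · exact le_rfl
      · exact mul_le_of_le_one_right ((hP.stochastic h).nonneg i k)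
          ((le_abs_self _).trans (hP.abs_le_one t k j))
    · split_ifs
      · exact le_rfl
      · exact mul_nonneg ((hP.stochastic h).nonneg i k) ((hP.stochastic t).nonneg k j)
  have h4 : 1 - ∑ k ∈ S', P h i k = - ∑ k ∈ S', d k := by
    have e1 := hone fun _ => 1
    have e2 := hext fun _ => 1
    simp only [mul_one] at e1 e2
    simp only [hd, Finset.sum_sub_distrib, ← Finset.mul_sum, e1, ← e2, hQ.sum_eq_zero hS]
    ring
  have h5 : ∑ k ∈ S', P h i k * P t k j - P t i j - h * ∑ k ∈ S i, Q i k * P t k j =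
      ∑ k ∈ S', d k * P t k j := by
    simp only [hd, sub_mul, Finset.sum_sub_distrib, hone fun k => P t k j, hext, mul_assoc,
      ← Finset.mul_sum]
  have h6 : |∑ k ∈ S', d k * P t k j| ≤ ∑ k ∈ S', |d k| := by
    refine (Finset.abs_sum_le_sum_abs _ _).trans (Finset.sum_le_sum fun k _ => ?_)
    rw [abs_mul]
    exact mul_le_of_le_one_right (abs_nonneg _) (hP.abs_le_one t k j)
  have h7 : - ∑ k ∈ S', d k ≤ ∑ k ∈ S', |d k| :=
    (neg_le_abs _).trans (Finset.abs_sum_le_sum_abs _ _)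
  calc _ = |(P (h + t) i j - ∑ k ∈ S', P h i k * P t k j) + ∑ k ∈ S', d k * P t k j| := by
        rw [← h5]; congr 1; ring
    _ ≤ _ := abs_add_le _ _
    _ ≤ _ := by linarith

/-- A Markov semigroup with a row-finite conservative `q`-matrix solves the backward equation. -/
theorem IsMarkovSemigroup.isBackwardSolution {P : ℝ≥0 → Matrix X X ℝ} (hP : IsMarkovSemigroup P)
    (hPQ : HasQMatrix P Q) (hQ : IsRateMatrix Q) (hS : ∀ i j, j ∉ S i → Q i j = 0) (j : X) :
    IsBackwardSolution Q S (fun t i => P t.toNNReal i j) := by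
  -- The bound of `abs_sub_sub_le` does not involve `t`, so `δ` is uniform in `t`; this also yields
  -- continuity of the entries in `t`.
  have huni : ∀ i, ∀ ε > 0, ∃ δ > 0, ∀ t : ℝ, 0 ≤ t → ∀ r : ℝ, 0 < r → r < δ →
      |P (t + r).toNNReal i j - P t.toNNReal i j -
        r * ∑ k ∈ S i, Q i k * P t.toNNReal k j| ≤ ε * r := by
    intro i ε hε
    have hlim : Tendsto (fun h : ℝ≥0 => 2 * ∑ k ∈ insert i (S i),
        |(P h i k - (1 : Matrix X X ℝ) i k) / (h : ℝ) - Q i k|) (𝓝[>] 0) (𝓝 0) := by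
      have := (tendsto_finsetSum (insert i (S i)) fun k _ =>
        ((hPQ i k).sub_const (Q i k)).abs).const_mul 2
      simpa using this
    have hev := hlim.eventually (gt_mem_nhds hε)
    obtain ⟨δ, hδ, H⟩ := (mem_nhdsGT_iff_exists_Ioo_subset' (zero_lt_one (α := ℝ≥0))).1 hev
    refine ⟨δ, hδ, fun t ht r hr hrδ => ?_⟩
    have hr' : 0 < r.toNNReal := Real.toNNReal_pos.2 hr
    have h1 := H ⟨hr', (Real.toNNReal_lt_iff_lt_coe hr.le).2 hrδ⟩
    simp only [Set.mem_ofPred_eq] at h1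
    have h2 := hP.abs_sub_sub_le hQ hS t.toNNReal r.toNNReal i j
    rw [add_comm r.toNNReal, ← Real.toNNReal_add ht hr.le, Real.coe_toNNReal r hr.le] at h2
    rw [Real.coe_toNNReal r hr.le] at h1
    refine h2.trans ?_
    calc _ = (2 * ∑ k ∈ insert i (S i),
          |(P r.toNNReal i k - (1 : Matrix X X ℝ) i k) / r - Q i k|) * r := by
          rw [mul_assoc, Finset.sum_mul]
          congr 1
          refine Finset.sum_congr rfl fun k _ => ?_
          rw [← abs_of_pos hr, ← abs_mul, abs_of_pos hr]
          congr 1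
          field_simp
      _ ≤ _ := mul_le_mul_of_nonneg_right h1.le hr.le
  have hcont : ∀ i, ContinuousOn (fun t : ℝ => P t.toNNReal i j) (Set.Ici 0) := fun i =>
    continuousOn_Ici_of_uniform (K := ∑ k ∈ S i, |Q i k|) (fun t _ => by
      refine (Finset.abs_sum_le_sum_abs _ _).trans (Finset.sum_le_sum fun k _ => ?_)
      rw [abs_mul]
      exact mul_le_of_le_one_right (abs_nonneg _) (hP.abs_le_one _ k j)) (huni i)
  intro t ht i
  exact hasDerivWithinAt_Ici_of_uniform (g := fun t => ∑ k ∈ S i, Q i k * P t.toNNReal k j)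
    (continuousOn_finsetSum _ fun k _ => continuousOn_const.mul (hcont k)) (huni i) ht

theorem tendsto_coe_nhdsGT_zero : Tendsto ((↑) : ℝ≥0 → ℝ) (𝓝[>] 0) (𝓝[>] 0) :=
  tendsto_nhdsWithin_of_tendsto_nhds_of_eventually_within _
    ((NNReal.continuous_coe.tendsto' 0 0 rfl).mono_left nhdsWithin_le_nhds)
    (by filter_upwards [self_mem_nhdsWithin] with h hh using NNReal.coe_pos.2 hh)

variable [Countable X] {W : X → ℝ} {C : ℝ}

/-- A row-finite rate matrix with a Lyapunov function is non-explosive. -/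
theorem isNonExplosive_of_lyapunov (hQ : IsRateMatrix Q) (hS : ∀ i j, j ∉ S i → Q i j = 0)
    (hW : ∀ i, 0 < W i) (hLyap : ∀ i, ∑ j ∈ S i, Q i j * W j ≤ C * W i)
    (hfin : ∀ R, {i | W i ≤ R}.Finite) : IsNonExplosive Q := by
  refine ⟨hQ, fun t ht => ⟨minimalSemigroup_nonneg hQ ht, fun i => ?_⟩⟩
  have hone : ∀ k : X, |(fun _ : X => (1 : ℝ)) k| ≤ 1 := by simp
  -- Row sums of the minimal semigroup and the constant $1$ are bounded solutions with the same
  -- initial value.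
  have hconst : IsBackwardSolution Q S (fun _ _ => 1) := by
    intro t _ i
    simpa [hQ.sum_eq_zero hS] using hasDerivWithinAt_const t (Set.Ici 0) (1 : ℝ)
  have h := (isBackwardSolution_tsum_minimalSemigroup_mul hQ hS hone).eq_of_bounded hconst
    hQ.nonneg hW hLyap hfin (fun i => by simp [minimalSemigroup_zero, Matrix.one_apply])
    (fun t ht i => abs_tsum_minimalSemigroup_mul_le hQ hS hone ht i) (by simp) ht i
  have h2 := (summable_minimalSemigroup_mul hQ hS hone ht i).hasSum
  rw [h] at h2
  simpa using h2

/-- A row-finite rate matrix with a Lyapunov function is the `q`-matrix of exactly one Markov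
semigroup, the minimal one. -/
theorem isUniqueMarkovSemigroup_of_lyapunov (hQ : IsRateMatrix Q)
    (hS : ∀ i j, j ∉ S i → Q i j = 0)
    (hW : ∀ i, 0 < W i) (hLyap : ∀ i, ∑ j ∈ S i, Q i j * W j ≤ C * W i)
    (hfin : ∀ R, {i | W i ≤ R}.Finite) :
    IsUniqueMarkovSemigroup (fun t : ℝ≥0 => minimalSemigroup Q t) Q := by
  have hsol := isBackwardSolution_minimalSemigroup hQ hS
  refine ⟨⟨fun t => (isNonExplosive_of_lyapunov hQ hS hW hLyap hfin).stochastic t t.2, ?_, ?_, ?_⟩,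
    ?_, ?_⟩
  · ext i j
    simp [minimalSemigroup_zero]
  · intro t s i j
    have hs : ∀ k, |minimalSemigroup Q s k j| ≤ 1 := fun k =>
      abs_minimalSemigroup_le_one hQ hS s.2 k j
    -- For fixed `s` and `j`, both sides of Chapman-Kolmogorov are bounded solutions in `t` that
    -- agree at `t = 0`.
    have h := (isBackwardSolution_tsum_minimalSemigroup_mul hQ hS hs).eq_of_bounded
      ((hsol j).comp_add s.2) hQ.nonneg hW hLyap hfin
      (fun i => by simp [minimalSemigroup_zero, Matrix.one_apply])
      (fun t ht i => abs_tsum_minimalSemigroup_mul_le hQ hS hs ht i)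
      (fun t ht i => abs_minimalSemigroup_le_one hQ hS (add_nonneg ht s.2) i j) t.2 i
    have h2 := (summable_minimalSemigroup_mul hQ hS hs t.2 i).hasSum
    rw [NNReal.coe_add]
    exact h ▸ h2
  · intro i j
    have h := ((hsol j).continuousOn i 0 Set.self_mem_Ici).tendsto
    rw [minimalSemigroup_zero] at h
    exact (h.mono_left (nhdsWithin_mono _ Set.Ioi_subset_Ici_self)).comp tendsto_coe_nhdsGT_zero
  · intro i j
    have h := (hsol j 0 le_rfl i).mono Set.Ioi_subset_Ici_self
    rw [hasDerivWithinAt_iff_tendsto_slope' (by simp)] at h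
    have h2 : ∑ k ∈ S i, Q i k * minimalSemigroup Q 0 k j = Q i j := by
      simp only [minimalSemigroup_zero, Matrix.one_apply, mul_ite, mul_one, mul_zero,
        Finset.sum_ite_eq']
      split_ifs with hj
      · rfl
      · exact (hS i j hj).symm
    rw [h2] at h
    refine (h.comp tendsto_coe_nhdsGT_zero).congr fun r => ?_
    simp [slope_def_field, minimalSemigroup_zero]
  · intro P' hP' hP'Q
    ext t i j
    have h := (hP'.isBackwardSolution hP'Q hQ hS j).eq_of_bounded (hsol j) hQ.nonneg hW hLyap hfin
      (fun i => by simp [minimalSemigroup_zero, hP'.zero])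
      (fun t _ i => hP'.abs_le_one _ i j)
      (fun t ht i => abs_minimalSemigroup_le_one hQ hS ht i j) t.2 i
    simpa using h

end Semigroup

/-! ### State space and polynomial Lyapunov functions for the single chain -/

section StateSpace

variable {e : ℕ → ℝ}

/-- Otherwise the increasing sequence converges to a limit it never attains, which is an
accumulation point. -/
theorem IsStateSpace.tendsto_atTop (he : IsStateSpace e) : Tendsto e atTop atTop := by
  rcases tendsto_atTop_of_monotone he.strictMono.monotone with h | ⟨a, ha⟩
  · exact h
  · refine absurd ?_ (he.no_accPt a)
    rw [accPt_iff_frequently]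
    refine ha.frequently (Eventually.frequently (Eventually.of_forall fun n => ⟨?_, n, rfl⟩))
    exact ((he.strictMono n.lt_succ_self).trans_le
      (he.strictMono.monotone.ge_of_tendsto ha (n + 1))).ne

theorem IsStateSpace.finite_le (he : IsStateSpace e) (R : ℝ) : {n | e n ≤ R}.Finite := by
  obtain ⟨n, hn⟩ := (he.tendsto_atTop.eventually_gt_atTop R).exists
  refine (Set.finite_Iio n).subset fun k hk => ?_
  by_contra! h
  exact absurd hk (not_le.2 (hn.trans_le (he.strictMono.monotone (not_lt.1 h))))

end StateSpace

section Tridiagonal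

variable {e : ℕ → ℝ} {Q : Matrix ℕ ℕ ℝ}

theorem IsTridiagonal.eq_zero_of_notMem (htri : IsTridiagonal Q) (x y : ℕ)
    (hy : y ∉ Finset.range (x + 2)) : Q x y = 0 := by
  by_contra h
  have := htri x y h
  rw [Finset.mem_range] at hy
  omega

theorem IsTridiagonal.diffOp_eq_sum (htri : IsTridiagonal Q) (f : ℕ → ℝ) (x : ℕ) :
    diffOp Q f x = ∑ y ∈ Finset.range (x + 2), Q x y * f y :=
  tsum_eq_sum fun y hy => by rw [htri.eq_zero_of_notMem x y hy, zero_mul]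

theorem exists_diffOp_pow_le (he : IsStateSpace e) (hpoly : PreservesPolynomials e Q) (m : ℕ) :
    ∃ C : ℝ, 0 ≤ C ∧ ∀ x, diffOp Q (fun y => e y ^ m) x ≤ C * (1 + e x) ^ m := by
  obtain ⟨-, p, hp, h⟩ := hpoly m
  refine ⟨∑ i ∈ Finset.range (m + 1), |p.coeff i|, by positivity, fun x => ?_⟩
  rw [h, eval_eq_sum_range' (Nat.lt_succ_of_le hp), Finset.sum_mul]
  refine Finset.sum_le_sum fun i hi => ?_
  have hx := he.nonneg x
  have h1 : e x ^ i ≤ (1 + e x) ^ m :=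
    (pow_le_pow_left₀ hx (by linarith) i).trans
      (pow_le_pow_right₀ (by linarith) (Nat.lt_succ_iff.1 (Finset.mem_range.1 hi)))
  calc p.coeff i * e x ^ i ≤ |p.coeff i| * e x ^ i :=
        mul_le_mul_of_nonneg_right (le_abs_self _) (by positivity)
    _ ≤ _ := by gcongr

/-- Expand $(1+y)^p$ binomially: each $\mathcal D x^m$ has degree at most $m\le p$, hence is at most
a constant times $(1+x)^p$ on $E\subset[0,\infty)$. -/
theorem exists_lyapunov_pow (he : IsStateSpace e) (htri : IsTridiagonal Q)
    (hpoly : PreservesPolynomials e Q) (p : ℕ) :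
    ∃ C : ℝ, 0 ≤ C ∧
      ∀ x, ∑ y ∈ Finset.range (x + 2), Q x y * (1 + e y) ^ p ≤ C * (1 + e x) ^ p := by
  choose C hC0 hC using fun m => exists_diffOp_pow_le he hpoly m
  refine ⟨∑ m ∈ Finset.range (p + 1), C m * p.choose m,
    Finset.sum_nonneg fun m _ => mul_nonneg (hC0 m) (Nat.cast_nonneg _), fun x => ?_⟩
  have h1 : ∀ y, (1 + e y) ^ p = ∑ m ∈ Finset.range (p + 1), e y ^ m * p.choose m := fun y => by
    rw [add_comm, add_pow]
    simp
  have hx := he.nonneg x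
  calc ∑ y ∈ Finset.range (x + 2), Q x y * (1 + e y) ^ p
      = ∑ m ∈ Finset.range (p + 1), diffOp Q (fun y => e y ^ m) x * p.choose m := by
        simp only [h1, htri.diffOp_eq_sum, Finset.mul_sum, Finset.sum_mul]
        rw [Finset.sum_comm]
        simp only [mul_assoc]
    _ ≤ ∑ m ∈ Finset.range (p + 1), C m * p.choose m * (1 + e x) ^ p := by
        refine Finset.sum_le_sum fun m hm => ?_
        have h2 : (1 + e x) ^ m ≤ (1 + e x) ^ p :=
          pow_le_pow_right₀ (by linarith) (Nat.lt_succ_iff.1 (Finset.mem_range.1 hm))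
        have h3 := (hC m x).trans (mul_le_mul_of_nonneg_left h2 (hC0 m))
        calc _ ≤ C m * (1 + e x) ^ p * p.choose m :=
              mul_le_mul_of_nonneg_right h3 (Nat.cast_nonneg _)
          _ = _ := by ring
    _ = _ := by rw [Finset.sum_mul]

end Tridiagonal

/-- The determinant of a matrix of solutions solves the backward equation of independent
components. -/
theorem IsBackwardSolution.hasDerivWithinAt_det {X Y : Type*} [DecidableEq X] {Q : Matrix X X ℝ}
    {S : X → Finset X} {p : ℝ → X → Y → ℝ} {N : ℕ}
    (hp : ∀ j, IsBackwardSolution Q S (fun t i => p t i j)) (x : Fin N → X) (y : Fin N → Y)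
    {t : ℝ} (ht : 0 ≤ t) :
    HasDerivWithinAt (fun s => (Matrix.of fun i j : Fin N => p s (x i) (y j)).det)
      (∑ i, ∑ m ∈ S (x i), Q (x i) m *
        (Matrix.of fun k j : Fin N => p t (Function.update x i m k) (y j)).det) (Set.Ici 0) t := by
  have hdet : ∀ (s : ℝ) (z : Fin N → X), (Matrix.of fun i j : Fin N => p s (z i) (y j)).det =
      ∑ σ : Equiv.Perm (Fin N), (Equiv.Perm.sign σ : ℝ) * ∏ i, p s (z i) (y (σ i)) := by
    intro s z
    -- Transposing puts the permutation on the columns, so changing `z i` affects a single factor of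
    -- each product.
    rw [← Matrix.det_transpose, Matrix.det_apply']
    simp
  simp only [hdet]
  refine (HasDerivWithinAt.fun_sum fun σ _ => (HasDerivWithinAt.fun_finsetProd fun i _ =>
    hp (y (σ i)) t ht (x i)).const_mul _).congr_deriv ?_
  have hprod : ∀ (σ : Equiv.Perm (Fin N)) (i : Fin N) (m : X),
      ∏ k, p t (Function.update x i m k) (y (σ k)) =
        (∏ k ∈ Finset.univ.erase i, p t (x k) (y (σ k))) * p t m (y (σ i)) := by
    intro σ i m
    rw [← Finset.prod_erase_mul _ _ (Finset.mem_univ i), Function.update_self]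
    congr 1
    refine Finset.prod_congr rfl fun k hk => ?_
    rw [Function.update_of_ne (Finset.ne_of_mem_erase hk)]
  simp only [hprod, Finset.mul_sum, smul_eq_mul]
  rw [Finset.sum_comm]
  refine Finset.sum_congr rfl fun i _ => ?_
  rw [Finset.sum_comm]
  refine Finset.sum_congr rfl fun m _ => Finset.sum_congr rfl fun σ _ => ?_
  ring

/-! ### Sign, zeros and growth of the Vandermonde product -/

section Vandermonde

variable {e : ℕ → ℝ} {N : ℕ}

theorem vandermonde_pos (he : IsStateSpace e) (x : OrderedTuple N) : 0 < vandermonde e x.1 :=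
  Finset.prod_pos fun _ _ => Finset.prod_pos fun _ hj =>
    sub_pos.2 (he.strictMono (x.2 (Finset.mem_Ioi.1 hj)))

theorem vandermonde_eq_zero {x : Fin N → ℕ} {a b : Fin N} (hab : a ≠ b) (h : x a = x b) :
    vandermonde e x = 0 := by
  wlog hlt : a < b generalizing a b
  · exact this hab.symm h.symm (lt_of_le_of_ne (not_lt.1 hlt) hab.symm)
  · exact Finset.prod_eq_zero (Finset.mem_univ a)
      (Finset.prod_eq_zero (Finset.mem_Ioi.2 hlt) (by rw [h, sub_self]))

theorem vandermonde_le (he : IsStateSpace e) (x : OrderedTuple N) (a : Fin N)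
    (ha : ∀ i, x.1 i ≤ x.1 a) : vandermonde e x.1 ≤ (1 + e (x.1 a)) ^ (N * N) := by
  have hM := he.nonneg (x.1 a)
  calc vandermonde e x.1 ≤ ∏ i : Fin N, (1 + e (x.1 a)) ^ N := by
        refine Finset.prod_le_prod (fun i _ => Finset.prod_nonneg fun j hj => ?_) fun i _ => ?_
        · exact (sub_pos.2 (he.strictMono (x.2 (Finset.mem_Ioi.1 hj)))).le
        · calc _ ≤ ∏ j ∈ Finset.Ioi i, (1 + e (x.1 a)) := by
                refine Finset.prod_le_prod (fun j hj => ?_) fun j _ => ?_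
                · exact (sub_pos.2 (he.strictMono (x.2 (Finset.mem_Ioi.1 hj)))).le
                · linarith [he.nonneg (x.1 j), he.strictMono.monotone (ha i)]
            _ = (1 + e (x.1 a)) ^ (Finset.Ioi i).card := Finset.prod_const _
            _ ≤ _ := pow_le_pow_right₀ (by linarith)
                ((Finset.card_le_univ _).trans_eq (Fintype.card_fin N))
    _ = _ := by rw [Finset.prod_const, Finset.card_univ, Fintype.card_fin, ← pow_mul]

end Vandermonde

/-! ### The h-transformed generator and the Karlin-McGregor determinant -/

section HTransform

variable {e : ℕ → ℝ} {Q : Matrix ℕ ℕ ℝ} {N : ℕ} {c : ℝ}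

/-- Distinct indices differ by at least one, so a move by at most one cannot pass a neighbour
without landing on it. -/
theorem exists_eq_of_not_strictAnti_update {x : Fin N → ℕ} (hx : StrictAnti x) {i : Fin N} {m : ℕ}
    (h1 : m ≤ x i + 1) (h2 : x i ≤ m + 1) (h : ¬ StrictAnti (Function.update x i m)) :
    ∃ a b, a ≠ b ∧ Function.update x i m a = Function.update x i m b := by
  simp only [StrictAnti, not_forall, not_lt] at h
  obtain ⟨a, b, hab, hle⟩ := h
  refine ⟨a, b, hab.ne, ?_⟩
  have hlt := hx hab
  by_cases ha : a = i
  · subst ha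
    rw [Function.update_self, Function.update_of_ne hab.ne'] at hle ⊢
    omega
  · rw [Function.update_of_ne ha] at hle ⊢
    by_cases hb : b = i
    · subst hb
      rw [Function.update_self] at hle ⊢
      omega
    · rw [Function.update_of_ne hb] at hle ⊢
      omega

open Classical in
/-- A finite set of ordered tuples containing all those reachable from `x` by one jump. -/
def tupleNhd (x : OrderedTuple N) : Finset (OrderedTuple N) :=
  (Fintype.piFinset fun i => Finset.range (x.1 i + 2)).subtype StrictAnti

theorem mem_tupleNhd {x y : OrderedTuple N} : y ∈ tupleNhd x ↔ ∀ i, y.1 i < x.1 i + 2 := by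
  simp [tupleNhd]

theorem hTransform_eq_zero_of_notMem (htri : IsTridiagonal Q) (x y : OrderedTuple N)
    (hy : y ∉ tupleNhd x) : hTransform N e Q c x y = 0 := by
  simp only [mem_tupleNhd, not_forall] at hy
  obtain ⟨i, hi⟩ := hy
  have hxy : x ≠ y := by
    rintro rfl
    omega
  rw [hTransform, if_neg hxy, Finset.sum_eq_zero, mul_zero, sub_zero]
  intro k _
  rw [ite_eq_right_iff]
  intro h
  rcases eq_or_ne i k with rfl | hik
  · exact htri.eq_zero_of_notMem _ _ (by rwa [Finset.mem_range])
  · have := h i hik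
    omega

open Classical in
/-- The sum over the tuples reachable by one jump, written coordinate by coordinate. -/
theorem sum_tupleNhd (x : OrderedTuple N) (g : (Fin N → ℕ) → ℝ) :
    ∑ y ∈ tupleNhd x, (∑ i, if ∀ j, j ≠ i → x.1 j = y.1 j then Q (x.1 i) (y.1 i) else 0) * g y.1 =
      ∑ i, ∑ m ∈ Finset.range (x.1 i + 2), if StrictAnti (Function.update x.1 i m) then
        Q (x.1 i) m * g (Function.update x.1 i m) else 0 := by
  simp only [Finset.sum_mul]
  rw [Finset.sum_comm]
  refine Finset.sum_congr rfl fun i _ => ?_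
  rw [← Finset.sum_filter]
  symm
  have hup : ∀ y : OrderedTuple N, (∀ j, j ≠ i → x.1 j = y.1 j) →
      Function.update x.1 i (y.1 i) = y.1 := by
    intro y h
    funext k
    rcases eq_or_ne k i with rfl | hk
    · simp
    · rw [Function.update_of_ne hk, h k hk]
  refine Finset.sum_bij_ne_zero
    (fun m hm _ => (⟨Function.update x.1 i m, (Finset.mem_filter.1 hm).2⟩ : OrderedTuple N))
    ?_ ?_ ?_ ?_
  · intro m hm _
    rw [mem_tupleNhd]
    intro k
    rcases eq_or_ne k i with rfl | hk
    · simpa using (Finset.mem_filter.1 hm).1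
    · simp [Function.update_of_ne hk]
  · intro m _ _ m' _ _ h
    simpa using congr_fun (congr_arg Subtype.val h) i
  · intro y hy hne
    have h : ∀ j, j ≠ i → x.1 j = y.1 j := by
      by_contra h
      exact hne (by rw [if_neg h, zero_mul])
    rw [if_pos h] at hne
    refine ⟨y.1 i, Finset.mem_filter.2 ⟨Finset.mem_range.2 (mem_tupleNhd.1 hy i), ?_⟩, ?_, ?_⟩
    · rw [hup y h]
      exact y.2
    · rwa [hup y h]
    · exact Subtype.ext (hup y h)
  · intro m _ _
    have h : ∀ j, j ≠ i → x.1 j = Function.update x.1 i m j := fun j hj => by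
      rw [Function.update_of_ne hj]
    simp only [if_pos h, Function.update_self]

-- The factor $\Delta_N(\mathbf y)$ in $Q^{(N)}$ cancels the denominator of the test function. What
-- remains is the free generator restricted to moves within $E_N$, shifted by $-c$.
open Classical in
theorem sum_hTransform_mul (he : IsStateSpace e) (x : OrderedTuple N) (g : (Fin N → ℕ) → ℝ) :
    ∑ y ∈ tupleNhd x, hTransform N e Q c x y * (g y.1 / vandermonde e y.1) =
      (∑ i, ∑ m ∈ Finset.range (x.1 i + 2), if StrictAnti (Function.update x.1 i m) then
        Q (x.1 i) m * g (Function.update x.1 i m) else 0) / vandermonde e x.1 -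
      c * (g x.1 / vandermonde e x.1) := by
  rw [← sum_tupleNhd, Finset.sum_div]
  have hx : x ∈ tupleNhd x := mem_tupleNhd.2 fun i => by omega
  have h : ∀ y : OrderedTuple N, hTransform N e Q c x y * (g y.1 / vandermonde e y.1) =
      (∑ i, if ∀ j, j ≠ i → x.1 j = y.1 j then Q (x.1 i) (y.1 i) else 0) * g y.1 /
        vandermonde e x.1 - if x = y then c * (g y.1 / vandermonde e y.1) else 0 := by
    intro y
    have := (vandermonde_pos he y).ne'
    have := (vandermonde_pos he x).ne'
    rw [hTransform, sub_mul, ite_mul, zero_mul]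
    congr 1
    field_simp
  simp only [h, Finset.sum_sub_distrib, Finset.sum_ite_eq, if_pos hx]

/-- The Karlin-McGregor step: a move out of $E_N$ has rate zero or ends in a collision, where `g`
vanishes, so the restriction to $E_N$ can be dropped. It is applied to `vandermonde e` and to
determinants. -/
theorem sum_hTransform_mul_of_alternating (he : IsStateSpace e) (htri : IsTridiagonal Q)
    (x : OrderedTuple N) {g : (Fin N → ℕ) → ℝ}
    (hg : ∀ z a b, a ≠ b → z a = z b → g z = 0) :
    ∑ y ∈ tupleNhd x, hTransform N e Q c x y * (g y.1 / vandermonde e y.1) =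
      (∑ i, ∑ m ∈ Finset.range (x.1 i + 2), Q (x.1 i) m * g (Function.update x.1 i m)) /
        vandermonde e x.1 - c * (g x.1 / vandermonde e x.1) := by
  classical
  rw [sum_hTransform_mul he]
  congr 2
  refine Finset.sum_congr rfl fun i _ => Finset.sum_congr rfl fun m _ => ?_
  split_ifs with h
  · rfl
  · by_cases hQ : Q (x.1 i) m = 0
    · rw [hQ, zero_mul]
    · have hm := htri _ _ hQ
      obtain ⟨a, b, hab, heq⟩ :=
        exists_eq_of_not_strictAnti_update x.2 (by omega) (by omega) h
      rw [hg _ a b hab heq, mul_zero]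

/-- Taking $g=\Delta_N$ makes the test function constant $1$, and the eigenvalue relation cancels
the shift by $c$. -/
theorem sum_hTransform (he : IsStateSpace e) (htri : IsTridiagonal Q)
    (heigen : ∀ x : Fin N → ℕ, freeOp Q (vandermonde e) x = c * vandermonde e x)
    (x : OrderedTuple N) : ∑ y ∈ tupleNhd x, hTransform N e Q c x y = 0 := by
  have h := sum_hTransform_mul_of_alternating (c := c) he htri x (g := vandermonde e)
    (fun z a b hab h => vandermonde_eq_zero hab h)
  have h2 := heigen x.1
  simp only [freeOp, htri.diffOp_eq_sum] at h2
  rw [h2, mul_div_assoc, sub_self] at h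
  rw [← h]
  exact Finset.sum_congr rfl fun y _ => by rw [div_self (vandermonde_pos he y).ne', mul_one]

theorem isRateMatrix_hTransform (he : IsStateSpace e) (hQ : IsRateMatrix Q)
    (htri : IsTridiagonal Q)
    (heigen : ∀ x : Fin N → ℕ, freeOp Q (vandermonde e) x = c * vandermonde e x) :
    IsRateMatrix (hTransform N e Q c) := by
  have hS := hTransform_eq_zero_of_notMem (e := e) (N := N) (c := c) htri
  refine ⟨fun x y hxy => ?_, fun x => ?_⟩
  · rw [hTransform, if_neg hxy, sub_zero]
    refine mul_nonneg (div_nonneg (vandermonde_pos he y).le (vandermonde_pos he x).le)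
      (Finset.sum_nonneg fun i _ => ?_)
    split_ifs with h
    · refine hQ.nonneg _ _ fun hi => hxy (Subtype.ext (funext fun j => ?_))
      rcases eq_or_ne j i with rfl | hj
      · exact hi
      · exact h j hj
    · exact le_rfl
  · have h := sum_eq_diag_add hS (fun _ => 1) x
    simp only [mul_one] at h
    rw [sum_hTransform he htri heigen] at h
    rw [neg_eq_of_add_eq_zero_right h.symm]
    exact hasSum_sum_of_ne_finset_zero fun y hy => by simp [hS x y hy]

/-- A suppressed move is never diagonal, so restoring it adds a nonnegative term. In the free
generator the unmoved coordinates drop out because rows of `Q` sum to zero, which leaves the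
one-variable inequality in each coordinate. -/
theorem lyapunov_hTransform (he : IsStateSpace e) (hQ : IsRateMatrix Q) (htri : IsTridiagonal Q)
    {φ : ℕ → ℝ} (hφ : ∀ x, 0 ≤ φ x) {C : ℝ}
    (hLyap : ∀ x, ∑ y ∈ Finset.range (x + 2), Q x y * φ y ≤ C * φ x) (x : OrderedTuple N) :
    ∑ y ∈ tupleNhd x, hTransform N e Q c x y * ((∑ k, φ (y.1 k)) / vandermonde e y.1) ≤
      (C - c) * ((∑ k, φ (x.1 k)) / vandermonde e x.1) := by
  classical
  rw [sum_hTransform_mul he x (fun z => ∑ k, φ (z k)), sub_mul, ← mul_div_assoc C]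
  refine sub_le_sub_right (div_le_div_of_nonneg_right ?_ (vandermonde_pos he x).le) _
  rw [Finset.mul_sum]
  refine Finset.sum_le_sum fun i _ => ?_
  have hsum : ∀ m, ∑ k, φ (Function.update x.1 i m k) =
      φ m + ∑ k ∈ Finset.univ.erase i, φ (x.1 k) := by
    intro m
    rw [← Finset.add_sum_erase _ _ (Finset.mem_univ i), Function.update_self]
    congr 1
    refine Finset.sum_congr rfl fun k hk => ?_
    rw [Function.update_of_ne (Finset.ne_of_mem_erase hk)]
  calc _ ≤ ∑ m ∈ Finset.range (x.1 i + 2), Q (x.1 i) m * ∑ k, φ (Function.update x.1 i m k) := by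
        refine Finset.sum_le_sum fun m _ => ?_
        split_ifs with h
        · exact le_rfl
        · refine mul_nonneg (hQ.nonneg _ _ ?_) (Finset.sum_nonneg fun k _ => hφ _)
          rintro rfl
          exact h (by rw [Function.update_eq_self]; exact x.2)
    _ = ∑ m ∈ Finset.range (x.1 i + 2), Q (x.1 i) m * φ m := by
        simp only [hsum, mul_add, Finset.sum_add_distrib, ← Finset.sum_mul,
          hQ.sum_eq_zero htri.eq_zero_of_notMem, zero_mul, add_zero]
    _ ≤ _ := hLyap _

theorem finite_setOf_le_orderedTuple (he : IsStateSpace e) (hN : 0 < N) (R : ℝ) :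
    {x : OrderedTuple N | e (x.1 ⟨0, hN⟩) ≤ R}.Finite := by
  obtain ⟨n, hn⟩ := (he.finite_le R).bddAbove
  refine Set.Finite.of_finite_image (f := Subtype.val)
    ((Set.finite_Iic (fun _ : Fin N => n)).subset ?_) Subtype.val_injective.injOn
  rintro _ ⟨x, hx, rfl⟩ i
  exact (x.2.antitone (Fin.mk_le_of_le_val (Nat.zero_le _))).trans (hn hx)

theorem det_one_apply (x y : OrderedTuple N) :
    (Matrix.of fun i j : Fin N => (1 : Matrix ℕ ℕ ℝ) (x.1 i) (y.1 j)).det =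
      (1 : Matrix (OrderedTuple N) (OrderedTuple N) ℝ) x y := by
  rcases eq_or_ne x y with rfl | hxy
  · rw [Matrix.one_apply_eq, ← Matrix.det_one (n := Fin N)]
    congr 1
    ext i j
    simp [Matrix.one_apply, x.2.injective.eq_iff]
  · rw [Matrix.one_apply_ne hxy]
    by_contra hdet
    -- A decreasing tuple is determined by its set of values; if these sets differ, some row or
    -- column is zero.
    refine hxy (Subtype.ext ((x.2.range_inj y.2).1 (Set.Subset.antisymm ?_ ?_)))
    · rintro _ ⟨i, rfl⟩
      by_contra h
      exact hdet (Matrix.det_eq_zero_of_row_eq_zero i fun j =>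
        Matrix.one_apply_ne fun hij => h ⟨j, hij.symm⟩)
    · rintro _ ⟨j, rfl⟩
      by_contra h
      exact hdet (Matrix.det_eq_zero_of_column_eq_zero j fun i =>
        Matrix.one_apply_ne fun hij => h ⟨i, hij⟩)

theorem det_eq_zero_of_eq {Y : Type*} (p : ℕ → Y → ℝ) (y : Fin N → Y) (z : Fin N → ℕ) (a b : Fin N)
    (hab : a ≠ b) (h : z a = z b) : (Matrix.of fun i j : Fin N => p (z i) (y j)).det = 0 :=
  Matrix.det_zero_of_row_eq hab (by ext j; simp [h])

/-- The `h`-transform of the Karlin-McGregor determinant. -/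
def karlinMcGregor (e : ℕ → ℝ) (c : ℝ) (p : ℝ → Matrix ℕ ℕ ℝ) (y : OrderedTuple N) (t : ℝ)
    (x : OrderedTuple N) : ℝ :=
  Real.exp (-c * t) * (vandermonde e y.1 / vandermonde e x.1) *
    (Matrix.of fun i j : Fin N => p t (x.1 i) (y.1 j)).det

theorem isBackwardSolution_karlinMcGregor (he : IsStateSpace e) (htri : IsTridiagonal Q)
    {p : ℝ → Matrix ℕ ℕ ℝ}
    (hp : ∀ j, IsBackwardSolution Q (fun x => Finset.range (x + 2)) (fun t i => p t i j))
    (y : OrderedTuple N) :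
    IsBackwardSolution (hTransform N e Q c) tupleNhd (karlinMcGregor e c p y) := by
  intro t ht x
  have h1 := (((hasDerivAt_exp_mul (-c) t).hasDerivWithinAt (s := Set.Ici 0)).mul_const
    (vandermonde e y.1 / vandermonde e x.1)).mul
    (IsBackwardSolution.hasDerivWithinAt_det hp x.1 y.1 ht)
  refine h1.congr_deriv ?_
  have h2 := sum_hTransform_mul_of_alternating (c := c) he htri x
    (g := fun z => (Matrix.of fun i j : Fin N => p t (z i) (y.1 j)).det)
    (fun z a b hab h => det_eq_zero_of_eq (p t) y.1 z a b hab h)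
  have h3 : ∑ z ∈ tupleNhd x, hTransform N e Q c x z * karlinMcGregor e c p y t z =
      Real.exp (-c * t) * vandermonde e y.1 * ∑ z ∈ tupleNhd x, hTransform N e Q c x z *
        ((Matrix.of fun i j : Fin N => p t (z.1 i) (y.1 j)).det / vandermonde e z.1) := by
    rw [Finset.mul_sum]
    refine Finset.sum_congr rfl fun z _ => ?_
    rw [karlinMcGregor]
    ring
  rw [h3, h2]
  ring

theorem karlinMcGregor_zero (he : IsStateSpace e) {p : ℝ → Matrix ℕ ℕ ℝ}
    (hp : p 0 = 1) (x y : OrderedTuple N) :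
    karlinMcGregor e c p y 0 x = (1 : Matrix (OrderedTuple N) (OrderedTuple N) ℝ) x y := by
  rw [karlinMcGregor, hp, det_one_apply, Matrix.one_apply]
  split_ifs with h
  · subst h
    simp [(vandermonde_pos he x).ne']
  · simp

theorem exists_abs_karlinMcGregor_le (he : IsStateSpace e) {p : ℝ → Matrix ℕ ℕ ℝ}
    (hp : ∀ t, 0 ≤ t → ∀ i j, |p t i j| ≤ 1) (y : OrderedTuple N) (T : ℝ) :
    ∃ A : ℝ, 0 ≤ A ∧ ∀ t ∈ Set.Icc 0 T, ∀ x,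
      |karlinMcGregor e c p y t x| ≤ A / vandermonde e x.1 := by
  have hy := vandermonde_pos he y
  refine ⟨Real.exp (|c| * T) * vandermonde e y.1 * (Nat.factorial N : ℝ), by positivity,
    fun t ht x => ?_⟩
  have hx := vandermonde_pos he x
  have h1 : |(Matrix.of fun i j : Fin N => p t (x.1 i) (y.1 j)).det| ≤ (Nat.factorial N : ℝ) := by
    have := Matrix.det_le (abv := AbsoluteValue.abs) (x := (1 : ℝ))
      (A := Matrix.of fun i j : Fin N => p t (x.1 i) (y.1 j)) fun i j => hp t ht.1 _ _
    simpa using this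
  have h2 : Real.exp (-c * t) ≤ Real.exp (|c| * T) := by
    refine Real.exp_le_exp.2 ?_
    calc -c * t ≤ |c| * t := mul_le_mul_of_nonneg_right (neg_le_abs c) ht.1
      _ ≤ |c| * T := mul_le_mul_of_nonneg_left ht.2 (abs_nonneg c)
  rw [karlinMcGregor, abs_mul, abs_of_pos (by positivity)]
  calc _ ≤ Real.exp (|c| * T) * (vandermonde e y.1 / vandermonde e x.1) *
        (Nat.factorial N : ℝ) := by gcongr
    _ = _ := by ring

end HTransform
end JumpChain

end

/-! ### Proof of the main theorem -/

open JumpChain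
theorem mainTheorem8 (e : ℕ → ℝ) (he : IsStateSpace e)
    (Q : Matrix ℕ ℕ ℝ) (hQ : IsNonExplosive Q) (htri : IsTridiagonal Q)
    (hpoly : PreservesPolynomials e Q)
    (N : ℕ) (hN : 1 ≤ N) (c : ℝ)
    (heigen : ∀ x : Fin N → ℕ, freeOp Q (vandermonde e) x = c * vandermonde e x) :
    IsNonExplosive (hTransform N e Q c) ∧
    ∃ (P₁ : ℝ≥0 → Matrix ℕ ℕ ℝ) (PN : ℝ≥0 → Matrix (OrderedTuple N) (OrderedTuple N) ℝ),
      IsUniqueMarkovSemigroup P₁ Q ∧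
      (∀ t : ℝ≥0, P₁ t = minimalSemigroup Q t) ∧
      IsUniqueMarkovSemigroup PN (hTransform N e Q c) ∧
      (∀ t : ℝ≥0, PN t = minimalSemigroup (hTransform N e Q c) t) ∧
      ∀ (t : ℝ≥0) (x y : OrderedTuple N),
        PN t x y =
          Real.exp (-c * t) * (vandermonde e y.1 / vandermonde e x.1) *
            (Matrix.of fun i j : Fin N => P₁ t (x.1 i) (y.1 j)).det := by
  have hR := hQ.isRateMatrix
  have hRN := isRateMatrix_hTransform he hR htri heigen
  have hSN := hTransform_eq_zero_of_notMem (e := e) (N := N) (c := c) htri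
  have hpos : ∀ n, 0 < 1 + e n := fun n => by linarith [he.nonneg n]
  obtain ⟨C₁, -, hC₁⟩ := exists_lyapunov_pow he htri hpoly 1
  -- Since $\Delta_N(\mathbf x)\le(1+x_1)^{N^2}$, one extra power gives $W(\mathbf x)\ge 1+x_1$,
  -- hence finite sublevel sets.
  obtain ⟨C, -, hC⟩ := exists_lyapunov_pow he htri hpoly (N * N + 1)
  set a : Fin N := ⟨0, hN⟩
  have hmax : ∀ (x : OrderedTuple N) i, x.1 i ≤ x.1 a := fun x i =>
    x.2.antitone (Fin.mk_le_of_le_val (Nat.zero_le _))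
  set W : OrderedTuple N → ℝ := fun x =>
    (∑ k, (1 + e (x.1 k)) ^ (N * N + 1)) / vandermonde e x.1 with hW
  have hsum : ∀ x : OrderedTuple N, (1 + e (x.1 a)) * (1 + e (x.1 a)) ^ (N * N) ≤
      ∑ k, (1 + e (x.1 k)) ^ (N * N + 1) := fun x => by
    rw [← pow_succ']
    exact Finset.single_le_sum (f := fun k => (1 + e (x.1 k)) ^ (N * N + 1))
      (fun k _ => (pow_pos (hpos _) _).le) (Finset.mem_univ a)
  have hWpos : ∀ x, 0 < W x := fun x => div_pos
    ((mul_pos (hpos _) (pow_pos (hpos _) _)).trans_le (hsum x)) (vandermonde_pos he x)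
  have hWle : ∀ x : OrderedTuple N, 1 + e (x.1 a) ≤ W x := fun x => by
    rw [hW, le_div_iff₀ (vandermonde_pos he x)]
    exact (mul_le_mul_of_nonneg_left (vandermonde_le he x a (hmax x)) (hpos _).le).trans (hsum x)
  have hLyap := lyapunov_hTransform (c := c) (N := N) he hR htri
    (fun x => (pow_pos (hpos x) (N * N + 1)).le) hC
  have hfin : ∀ R, {x | W x ≤ R}.Finite := fun R =>
    (finite_setOf_le_orderedTuple he hN R).subset fun x (hx : W x ≤ R) =>
      show e (x.1 a) ≤ R by linarith [hWle x]
  refine ⟨isNonExplosive_of_lyapunov hRN hSN hWpos hLyap hfin,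
    fun t => minimalSemigroup Q t, fun t => minimalSemigroup (hTransform N e Q c) t,
    isUniqueMarkovSemigroup_of_lyapunov hR htri.eq_zero_of_notMem
      (W := fun n => (1 + e n) ^ 1) (fun n => pow_pos (hpos n) 1) hC₁ (fun R => ?_),
    fun _ => rfl, isUniqueMarkovSemigroup_of_lyapunov hRN hSN hWpos hLyap hfin, fun _ => rfl,
    fun t x y => ?_⟩
  · refine (he.finite_le R).subset fun n (hn : (1 + e n) ^ 1 ≤ R) => ?_
    rw [pow_one] at hn
    show e n ≤ R
    linarith
  -- The determinant side is not known to be bounded, so `eq_zero` is used with its growth condition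
  -- in place of `eq_of_bounded`.
  have hsol := (isBackwardSolution_minimalSemigroup hRN hSN y).sub
    (isBackwardSolution_karlinMcGregor (c := c) he htri
      (isBackwardSolution_minimalSemigroup hR htri.eq_zero_of_notMem) y)
  refine sub_eq_zero.1 (hsol.eq_zero hRN.nonneg hWpos hLyap (fun x => ?_) (fun T ε hε => ?_) t.2 x)
  · rw [minimalSemigroup_zero, karlinMcGregor_zero he (by ext; simp [minimalSemigroup_zero]),
      sub_self]
  · obtain ⟨A, hA, hbound⟩ := exists_abs_karlinMcGregor_le (c := c) he
      (fun t ht i j => abs_minimalSemigroup_le_one hR htri.eq_zero_of_notMem ht i j) y T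
    refine (finite_setOf_le_orderedTuple he hN ((1 + A) / ε)).subset ?_
    rintro x ⟨t, ht, h⟩
    show e (x.1 a) ≤ _
    have hx := vandermonde_pos he x
    have hM := hpos (x.1 a)
    have h1 := abs_minimalSemigroup_le_one hRN hSN ht.1 x y
    have h2 := hbound t ht x
    have h3 := h.trans_le ((abs_sub _ _).trans (add_le_add h1 h2))
    -- With $\Delta_N(\mathbf x)$ cleared, $\varepsilon(1+x_1)^{N^2+1}<\Delta_N(\mathbf
    -- x)+A\le(1+A)(1+x_1)^{N^2}$, so $x_1$ is bounded by $(1+A)/\varepsilon$.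
    rw [hW, ← mul_div_assoc, one_add_div hx.ne', div_lt_div_iff_of_pos_right hx] at h3
    have hone : 1 ≤ (1 + e (x.1 a)) ^ (N * N) := one_le_pow₀ (by linarith [he.nonneg (x.1 a)])
    have h4 : ε * (1 + e (x.1 a)) * (1 + e (x.1 a)) ^ (N * N) <
        (1 + A) * (1 + e (x.1 a)) ^ (N * N) := by
      calc _ = ε * ((1 + e (x.1 a)) * (1 + e (x.1 a)) ^ (N * N)) := by ring
        _ ≤ _ := mul_le_mul_of_nonneg_left (hsum x) hε.le
        _ < _ := h3
        _ ≤ (1 + e (x.1 a)) ^ (N * N) + A * (1 + e (x.1 a)) ^ (N * N) :=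
          add_le_add (vandermonde_le he x a (hmax x)) (le_mul_of_one_le_right hA hone)
        _ = _ := by ring
    have h5 := lt_of_mul_lt_mul_right h4 (zero_le_one.trans hone)
    rw [le_div_iff₀ hε]
    linarith
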